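/- For $n\ge 2$ let $CV_n$ be Culler--Vogtmann space: the set of finite connected metric graphs $A$ with all vertices of valence at least $3$, equipped with a marking (a homotopy equivalence $\tau_A:R_n\to A$ from the rose with $n$ petals), where $A$ and $B$ are identified if there is a homothety $h:A\to B$ with $h\circ\tau_A$ freely homotopic to $\tau_B$. For $w\in F_n=\pi_1(R_n)$ let $l_A(w)$ be the length of the shortest loop in the free homotopy class determined by $w$. The topology of $CV_n$ is the subspace topology given by the embedding $A\mapsto [l_A]$ into $\mathbb R^{F_n}/\!\sim$, where $\sim$ is multiplication by positive scalars. With $\bar A$ the representative of $A$ of total volume one, put $$\Lambda_R(A,B)=\sup_{1\ne w\in F_n}\frac{l_B(w)}{l_A(w)},\qquad \Lambda_L(A,B)=\sup_{1\ne w\in F_n}\frac{l_A(w)}{l_B(w)},$$ $$d_R(A,B)=\log\Lambda_R(\bar A,\bar B),\qquad d_L(A,B)=\log\Lambda_L(\bar A,\bar B),\qquad d(A,B)=\log\bigl(\Lambda_R(A,B)\Lambda_L(A,B)\bigr).$$ For $D\in\{d,d_R,d_L\}$, a $D$-geodesic from $P$ to $Q$ is a continuous path $\gamma:[0,1]\to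 CV_n$ from $P$ to $Q$ whose $D$-length, the supremum of $\sum_i D(\gamma(t_{i-1}),\gamma(t_i))$ over the subdivisions of $[0,1]$, equals $D(P,Q)$. Let $F_2$ be free on $a,b$. Let $X\in CV_2$ be the theta-graph with three edges $A,B,C$ from one vertex to the other, of lengths $\tfrac16,\tfrac13,\tfrac12$, marked by $a\mapsto AB^{-1}$, $b\mapsto CB^{-1}$. Let $Y\in CV_2$ be the theta-graph with three edges $E,F,G$ from one vertex to the other, of lengths $\tfrac12,\tfrac13,\tfrac16$, marked by $a\mapsto EF^{-1}$, $b\mapsto FG^{-1}$. For $0<\alpha<1$ let $T_\alpha\in CV_2$ be the rose whose petals $a$ and $b$ have lengths $\alpha$ and $1-\alpha$. Let $\sigma_X$ and $\sigma_Y$ be the open simplices of $CV_2$ obtained from $X$ and from $Y$ by letting the three edge lengths be arbitrary positive numbers. Then: 1. $X\in\sigma_X$, $Y\in\sigma_Y$, and the closures of $\sigma_X$ and $\sigma_Y$ in $CV_2$ meet exactly in the common edge $\{T_\alpha: 0<\alpha<1\}$. 2. There is no $d$-geodesic from $X$ to $Y$. 3. Every $d_R$-geodesic from $X$ to $Y$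 meets the common edge, and meets it only at the point $T_{5/8}$. 4. Every $d_L$-geodesic from $X$ to $Y$ meets the common edge, and meets it only at the point $T_{3/8}$. 5. Hence $(CV_n,d)$ is not a geodesic space: for every $n\ge 2$ there are two points of $CV_n$ that are not joined by a $d$-geodesic. -/

import Mathlib

namespace OuterSpaceMetric

/-! ### Finite metric graphs and edge paths -/

/-- A finite metric graph (loops and multiple edges allowed). Every edge carries an auxiliary
orientation, from `src` to `tgt`, and a positive length. -/
structure MetricGraph where
  V : Type
  E : Type
  [finV : Finite V]
  [finE : Fintype E]
  src : E → V
  tgt : E → V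
  len : E → ℝ
  len_pos : ∀ e, 0 < len e

attribute [instance] MetricGraph.finV MetricGraph.finE

namespace MetricGraph

variable (G : MetricGraph)

/-- Origin of an oriented edge: `(e, true)` is `e` run from `src e` to `tgt e`, and `(e, false)` is
the same edge run backwards. -/
def start (x : G.E × Bool) : G.V := bif x.2 then G.src x.1 else G.tgt x.1

/-- Endpoint of an oriented edge. -/
def finish (x : G.E × Bool) : G.V := bif x.2 then G.tgt x.1 else G.src x.1

/-- `G.IsWalk u p w`: the list `p` of oriented edges is an edge path from `u` to `w`. -/
def IsWalk : G.V → List (G.E × Bool) → G.V → Prop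
  | u, [], w => u = w
  | u, x :: p, w => G.start x = u ∧ IsWalk (G.finish x) p w

/-- Length of an edge path. -/
def pathLength (p : List (G.E × Bool)) : ℝ := (p.map fun x => G.len x.1).sum

/-- Total volume. -/
noncomputable def volume : ℝ := ∑ e, G.len e

/-- Number of oriented edges issuing from `v` (a loop at `v` counts twice). -/
noncomputable def valence (v : G.V) : ℕ := Nat.card {x : G.E × Bool // G.start x = v}

def Connected : Prop := ∀ u w, ∃ p, G.IsWalk u p w

variable {G}

theorem IsWalk.append {u v w : G.V} {p q : List (G.E × Bool)}
    (hp : G.IsWalk u p v) (hq : G.IsWalk v q w) : G.IsWalk u (p ++ q) w := by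
  induction p generalizing u with
  | nil => cases hp; exact hq
  | cons x p ih => exact ⟨hp.1, ih hp.2⟩

theorem IsWalk.invRev {u v : G.V} {p : List (G.E × Bool)}
    (hp : G.IsWalk u p v) : G.IsWalk v (FreeGroup.invRev p) u := by
  induction p generalizing u with
  | nil => cases hp; rfl
  | cons x p ih =>
    obtain ⟨e, b⟩ := x
    rw [FreeGroup.invRev_cons]
    refine (ih hp.2).append ?_
    have h := hp.1
    cases b <;> exact ⟨rfl, h⟩

variable (G)

/-- The fundamental group `π₁(G, v)`: closed edge paths at `v` up to insertion and deletion of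
backtracks. Two edge paths are homotopic if and only if they have the same class in the free group
on the edges, so the group is realised as a subgroup of that free group. -/
def fundamentalGroup (v : G.V) : Subgroup (FreeGroup G.E) where
  carrier := {g | ∃ p, G.IsWalk v p v ∧ FreeGroup.mk p = g}
  one_mem' := ⟨[], rfl, rfl⟩
  mul_mem' := by
    rintro _ _ ⟨p, hp, rfl⟩ ⟨q, hq, rfl⟩
    exact ⟨p ++ q, hp.append hq, FreeGroup.mul_mk.symm⟩
  inv_mem' := by
    rintro _ ⟨p, hp, rfl⟩
    exact ⟨_, hp.invRev, FreeGroup.inv_mk.symm⟩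

/-- A homothety `G → H`: an isomorphism of graphs that multiplies all lengths by one factor. The
edge `e` goes to `onE e`, with the orientations agreeing when `dir e = true` and opposite when
`dir e = false`. (A homothety of graphs all of whose vertices have valence at least three maps
vertices to vertices.) -/
structure Homothety (G H : MetricGraph) where
  onV : G.V ≃ H.V
  onE : G.E ≃ H.E
  dir : G.E → Bool
  start_eq : ∀ e, H.start (onE e, dir e) = onV (G.src e)
  finish_eq : ∀ e, H.finish (onE e, dir e) = onV (G.tgt e)
  ratio : ℝ
  ratio_pos : 0 < ratio
  len_eq : ∀ e, H.len (onE e) = ratio * G.len e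

namespace Homothety

variable {G H K : MetricGraph} (h : Homothety G H)

/-- The image of an oriented edge. -/
def edge (x : G.E × Bool) : H.E × Bool := (h.onE x.1, x.2 == h.dir x.1)

/-- The map induced on homotopy classes of edge paths. -/
def induced : FreeGroup G.E →* FreeGroup H.E :=
  FreeGroup.lift fun e => FreeGroup.mk [(h.onE e, h.dir e)]

theorem start_edge (x : G.E × Bool) : H.start (h.edge x) = h.onV (G.start x) := by
  obtain ⟨e, b⟩ := x
  have h1 := h.start_eq e
  have h2 := h.finish_eq e
  rcases hd : h.dir e <;> cases b <;> simp_all [edge, start, finish]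

theorem finish_edge (x : G.E × Bool) : H.finish (h.edge x) = h.onV (G.finish x) := by
  obtain ⟨e, b⟩ := x
  have h1 := h.start_eq e
  have h2 := h.finish_eq e
  rcases hd : h.dir e <;> cases b <;> simp_all [edge, start, finish]

theorem isWalk_map {u v : G.V} {p : List (G.E × Bool)} (hp : G.IsWalk u p v) :
    H.IsWalk (h.onV u) (p.map h.edge) (h.onV v) := by
  induction p generalizing u with
  | nil => cases hp; rfl
  | cons x p ih =>
    refine ⟨?_, ?_⟩
    · rw [h.start_edge, hp.1]
    · rw [h.finish_edge]; exact ih hp.2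

theorem induced_mk (p : List (G.E × Bool)) : h.induced (FreeGroup.mk p) = FreeGroup.mk (p.map h.edge) := by
  induction p with
  | nil => exact map_one _
  | cons x p ih =>
    have e1 : (FreeGroup.mk (x :: p) : FreeGroup G.E) = FreeGroup.mk [x] * FreeGroup.mk p := by simp
    have e2 : (FreeGroup.mk (List.map h.edge (x :: p)) : FreeGroup H.E)
        = FreeGroup.mk [h.edge x] * FreeGroup.mk (p.map h.edge) := by simp
    rw [e1, e2, map_mul, ih]
    congr 1
    obtain ⟨e, b⟩ := x
    rcases hd : h.dir e <;> cases b <;> simp [induced, edge, hd, FreeGroup.invRev]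

theorem pathLength_map (p : List (G.E × Bool)) :
    H.pathLength (p.map h.edge) = h.ratio * G.pathLength p := by
  induction p with
  | nil => simp [pathLength]
  | cons x p ih =>
    simp only [pathLength, List.map_cons, List.sum_cons] at ih ⊢
    rw [ih, mul_add]
    congr 1
    exact h.len_eq x.1

theorem volume_eq : H.volume = h.ratio * G.volume := by
  rw [volume, volume, Finset.mul_sum, ← h.onE.sum_comp]
  exact Finset.sum_congr rfl fun e _ => h.len_eq e

def refl (G : MetricGraph) : Homothety G G where
  onV := Equiv.refl _
  onE := Equiv.refl _
  dir _ := true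
  start_eq _ := rfl
  finish_eq _ := rfl
  ratio := 1
  ratio_pos := one_pos
  len_eq _ := (one_mul _).symm

noncomputable def symm : Homothety H G where
  onV := h.onV.symm
  onE := h.onE.symm
  dir e := h.dir (h.onE.symm e)
  start_eq e := by
    obtain ⟨e, rfl⟩ := h.onE.surjective e
    have h1 := h.start_eq e
    have h2 := h.finish_eq e
    rcases hd : h.dir e <;> simp_all [start, finish]
  finish_eq e := by
    obtain ⟨e, rfl⟩ := h.onE.surjective e
    have h1 := h.start_eq e
    have h2 := h.finish_eq e
    rcases hd : h.dir e <;> simp_all [start, finish]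
  ratio := h.ratio⁻¹
  ratio_pos := inv_pos.2 h.ratio_pos
  len_eq e := by
    obtain ⟨e, rfl⟩ := h.onE.surjective e
    rw [h.len_eq, Equiv.symm_apply_apply, inv_mul_cancel_left₀ h.ratio_pos.ne']

noncomputable def trans (k : Homothety H K) : Homothety G K where
  onV := h.onV.trans k.onV
  onE := h.onE.trans k.onE
  dir e := h.dir e == k.dir (h.onE e)
  start_eq e := by
    have h1 := k.start_edge (h.onE e, h.dir e)
    rw [h.start_eq] at h1
    exact h1
  finish_eq e := by
    have h1 := k.finish_edge (h.onE e, h.dir e)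
    rw [h.finish_eq] at h1
    exact h1
  ratio := k.ratio * h.ratio
  ratio_pos := mul_pos k.ratio_pos h.ratio_pos
  len_eq e := by
    rw [Equiv.trans_apply, k.len_eq, h.len_eq, mul_assoc]

theorem refl_induced (g : FreeGroup G.E) : (refl G).induced g = g := by
  have : (refl G).induced = MonoidHom.id _ := by
    ext e
    simp [induced, refl, FreeGroup.of]
  rw [this]; rfl

theorem symm_induced (g : FreeGroup G.E) : h.symm.induced (h.induced g) = g := by
  have : h.symm.induced.comp h.induced = MonoidHom.id _ := by
    ext e
    have : FreeGroup.of e = FreeGroup.mk [(e, true)] := rfl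
    simp only [MonoidHom.comp_apply, MonoidHom.id_apply]
    rw [this, induced_mk, induced_mk]
    rcases hd : h.dir e <;> simp [edge, symm, hd]
  exact DFunLike.congr_fun this g

theorem trans_induced (k : Homothety H K) (g : FreeGroup G.E) :
    (h.trans k).induced g = k.induced (h.induced g) := by
  have : (h.trans k).induced = k.induced.comp h.induced := by
    ext e
    have : FreeGroup.of e = FreeGroup.mk [(e, true)] := rfl
    simp only [MonoidHom.comp_apply]
    rw [this, induced_mk, induced_mk, induced_mk]
    rcases hd : h.dir e <;> rcases hk : k.dir (h.onE e) <;> simp [edge, trans, hd, hk]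
  exact DFunLike.congr_fun this g

end Homothety

end MetricGraph

/-! ### Marked metric graphs and the space `CV_n` -/

/-- A finite connected metric graph, all vertices of valence at least three, with a marking: a
homotopy equivalence from the rose with `n` petals. Such a map is given, up to homotopy, by the
image `base` of the vertex of the rose and the isomorphism `F_n → π₁(graph, base)`. -/
structure MarkedGraph (n : ℕ) extends MetricGraph where
  connected : toMetricGraph.Connected
  three_le_valence : ∀ v, 3 ≤ toMetricGraph.valence v
  base : V
  marking : FreeGroup (Fin n) →* FreeGroup E
  marking_injective : Function.Injective marking
  marking_range : marking.range = toMetricGraph.fundamentalGroup base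

namespace MarkedGraph

open MetricGraph

variable {n : ℕ}

/-- `A` and `B` are equivalent if there is a homothety `h : A → B` such that `h ∘ τ_A` and `τ_B` are
freely homotopic; `q` is the path run by the image of the vertex of the rose. -/
def Equivalent (A B : MarkedGraph n) : Prop :=
  ∃ (h : Homothety A.toMetricGraph B.toMetricGraph) (q : List (B.E × Bool)),
    B.IsWalk (h.onV A.base) q B.base ∧
      ∀ w, h.induced (A.marking w) = FreeGroup.mk q * B.marking w * (FreeGroup.mk q)⁻¹

theorem Equivalent.refl (A : MarkedGraph n) : Equivalent A A :=
  ⟨Homothety.refl _, [], rfl, fun w => by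
    rw [Homothety.refl_induced, ← FreeGroup.one_eq_mk]; simp⟩

theorem Equivalent.symm {A B : MarkedGraph n} (hAB : Equivalent A B) : Equivalent B A := by
  obtain ⟨h, q, hq, hw⟩ := hAB
  refine ⟨h.symm, (FreeGroup.invRev q).map h.symm.edge, ?_, fun w => ?_⟩
  · have := h.symm.isWalk_map hq.invRev
    rwa [show h.symm.onV (h.onV A.base) = A.base from h.onV.symm_apply_apply _] at this
  · have e : B.marking w = (FreeGroup.mk q)⁻¹ * h.induced (A.marking w) * FreeGroup.mk q := by
      rw [hw]; group
    rw [← Homothety.induced_mk, ← FreeGroup.inv_mk, e, map_mul, map_mul, h.symm_induced, map_inv,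
      inv_inv]

theorem Equivalent.trans {A B C : MarkedGraph n} (hAB : Equivalent A B) (hBC : Equivalent B C) :
    Equivalent A C := by
  obtain ⟨h, q, hq, hw⟩ := hAB
  obtain ⟨k, r, hr, hv⟩ := hBC
  refine ⟨h.trans k, q.map k.edge ++ r, (k.isWalk_map hq).append hr, fun w => ?_⟩
  rw [Homothety.trans_induced, hw, map_mul, map_mul, hv, map_inv, Homothety.induced_mk,
    ← FreeGroup.mul_mk]
  group

instance setoid (n : ℕ) : Setoid (MarkedGraph n) :=
  ⟨Equivalent, Equivalent.refl, Equivalent.symm, Equivalent.trans⟩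

/-- The lengths of the closed edge paths `p` in the free homotopy class given by `w`. -/
def loopLengths (A : MarkedGraph n) (w : FreeGroup (Fin n)) : Set ℝ :=
  {L | ∃ u p q, A.IsWalk A.base q u ∧ A.IsWalk u p u ∧
    A.marking w = FreeGroup.mk q * FreeGroup.mk p * (FreeGroup.mk q)⁻¹ ∧ L = A.pathLength p}

/-- The translation length `l_A(w)`: the length of the shortest representative of the free homotopy
class of loops in `A` given by `w`. -/
noncomputable def length (A : MarkedGraph n) (w : FreeGroup (Fin n)) : ℝ := sInf (A.loopLengths w)

/-- The translation length in the representative of `A` of total volume one. -/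
noncomputable def unitLength (A : MarkedGraph n) (w : FreeGroup (Fin n)) : ℝ :=
  A.length w / A.volume

theorem loopLengths_subset {A B : MarkedGraph n} (h : Homothety A.toMetricGraph B.toMetricGraph)
    {r : List (B.E × Bool)} (hr : B.IsWalk (h.onV A.base) r B.base)
    (hw : ∀ w, h.induced (A.marking w) = FreeGroup.mk r * B.marking w * (FreeGroup.mk r)⁻¹) (w : FreeGroup (Fin n))
    {L : ℝ} (hL : L ∈ A.loopLengths w) : h.ratio * L ∈ B.loopLengths w := by
  obtain ⟨u, p, q, hq, hp, e, rfl⟩ := hL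
  refine ⟨h.onV u, p.map h.edge, FreeGroup.invRev r ++ q.map h.edge,
    hr.invRev.append (h.isWalk_map hq), h.isWalk_map hp, ?_, (h.pathLength_map p).symm⟩
  have e1 := hw w
  rw [e, map_mul, map_mul, map_inv, Homothety.induced_mk, Homothety.induced_mk] at e1
  rw [← FreeGroup.mul_mk, ← FreeGroup.inv_mk]
  have e2 : B.marking w = (FreeGroup.mk r)⁻¹ * (FreeGroup.mk r * B.marking w * (FreeGroup.mk r)⁻¹) * FreeGroup.mk r := by group
  rw [e2, ← e1]
  group

theorem loopLengths_nonneg (A : MarkedGraph n) (w : FreeGroup (Fin n)) :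
    ∀ L ∈ A.loopLengths w, 0 ≤ L := by
  rintro _ ⟨u, p, q, -, -, -, rfl⟩
  refine List.sum_nonneg fun x hx => ?_
  obtain ⟨y, -, rfl⟩ := List.mem_map.1 hx
  exact (A.len_pos _).le

theorem loopLengths_nonempty (A : MarkedGraph n) (w : FreeGroup (Fin n)) :
    (A.loopLengths w).Nonempty := by
  have hm : A.marking w ∈ A.fundamentalGroup A.base := A.marking_range ▸ ⟨w, rfl⟩
  obtain ⟨p, hp, e⟩ := hm
  refine ⟨_, A.base, p, [], rfl, hp, ?_, rfl⟩
  rw [← FreeGroup.one_eq_mk, e]; simp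

theorem length_le_of_homothety {A B : MarkedGraph n}
    (h : Homothety A.toMetricGraph B.toMetricGraph)
    {r : List (B.E × Bool)} (hr : B.IsWalk (h.onV A.base) r B.base)
    (hw : ∀ w, h.induced (A.marking w) = FreeGroup.mk r * B.marking w * (FreeGroup.mk r)⁻¹) (w : FreeGroup (Fin n)) :
    B.unitLength w ≤ A.unitLength w := by
  have hle : B.length w / h.ratio ≤ A.length w := by
    refine le_csInf (A.loopLengths_nonempty w) fun L hL => ?_
    rw [div_le_iff₀' h.ratio_pos]
    exact csInf_le ⟨0, B.loopLengths_nonneg w⟩ (loopLengths_subset h hr hw w hL)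
  have hv : 0 ≤ A.volume := Finset.sum_nonneg fun e _ => (A.len_pos e).le
  calc B.unitLength w = B.length w / h.ratio / A.volume := by
        rw [unitLength, h.volume_eq, div_div]
    _ ≤ A.unitLength w := div_le_div_of_nonneg_right hle hv

theorem Equivalent.unitLength_eq {A B : MarkedGraph n} (hAB : Equivalent A B) :
    A.unitLength = B.unitLength := by
  funext w
  refine le_antisymm ?_ ?_
  · obtain ⟨h, r, hr, hw⟩ := hAB.symm
    exact length_le_of_homothety h hr hw w
  · obtain ⟨h, r, hr, hw⟩ := hAB
    exact length_le_of_homothety h hr hw w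

end MarkedGraph

/-- Culler-Vogtmann space `CV_n` of rank `n`. -/
def CV (n : ℕ) : Type 1 := Quotient (MarkedGraph.setoid n)

/-- Homothety of real functions on the free group. -/
def homothetySetoid (n : ℕ) : Setoid (FreeGroup (Fin n) → ℝ) where
  r f g := ∃ c : ℝ, 0 < c ∧ ∀ w, g w = c * f w
  iseqv :=
    { refl := fun _ => ⟨1, one_pos, fun _ => (one_mul _).symm⟩
      symm := by
        rintro f g ⟨c, hc, h⟩
        exact ⟨c⁻¹, inv_pos.2 hc, fun w => by rw [h, inv_mul_cancel_left₀ hc.ne']⟩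
      trans := by
        rintro f g k ⟨c, hc, h⟩ ⟨c', hc', h'⟩
        exact ⟨c' * c, mul_pos hc' hc, fun w => by rw [h', h, mul_assoc]⟩ }

namespace CV

variable {n : ℕ}

/-- The class of a marked metric graph. -/
def of (A : MarkedGraph n) : CV n := Quotient.mk _ A

/-- The translation length function of the representative of volume one. -/
noncomputable def unitLength (A : CV n) : FreeGroup (Fin n) → ℝ :=
  Quotient.lift MarkedGraph.unitLength (fun _ _ h => MarkedGraph.Equivalent.unitLength_eq h) A

/-- `CV_n` has the subspace topology of the projectivised space of real functions on `F_n`, into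
which it embeds by length functions. -/
noncomputable instance : TopologicalSpace (CV n) :=
  TopologicalSpace.induced
    (fun A => (Quotient.mk (homothetySetoid n) A.unitLength : Quotient (homothetySetoid n)))
    inferInstance

/-- `Λ_R(A, B)`, for the representatives of volume one. -/
noncomputable def stretchR (A B : CV n) : ℝ :=
  ⨆ w : {w : FreeGroup (Fin n) // w ≠ 1}, B.unitLength w / A.unitLength w

/-- `Λ_L(A, B)`, for the representatives of volume one. -/
noncomputable def stretchL (A B : CV n) : ℝ :=
  ⨆ w : {w : FreeGroup (Fin n) // w ≠ 1}, A.unitLength w / B.unitLength w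

/-- The right hand metric `d_R`. -/
noncomputable def dR (A B : CV n) : ℝ := Real.log (stretchR A B)

/-- The left hand metric `d_L`. -/
noncomputable def dL (A B : CV n) : ℝ := Real.log (stretchL A B)

/-- The symmetric metric `d`. -/
noncomputable def d (A B : CV n) : ℝ := Real.log (stretchR A B * stretchL A B)

end CV

/-! ### Geodesics of a possibly non-symmetric metric -/

section Geodesics

variable {M : Type*} [TopologicalSpace M]

/-- The sums `∑ D(γ(t_{i-1}), γ(t_i))` over the subdivisions `0 = t_0 ≤ ⋯ ≤ t_k = 1`; their supremum
is the length of `γ`. -/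
def subdivisionSums (D : M → M → ℝ) {x y : M} (γ : Path x y) : Set ℝ :=
  {s | ∃ (k : ℕ) (t : ℕ → unitInterval), Monotone t ∧ t 0 = 0 ∧ t k = 1 ∧
    s = ∑ i ∈ Finset.range k, D (γ (t i)) (γ (t (i + 1)))}

/-- A continuous path is a `D`-geodesic if its `D`-length is the `D`-distance from its initial point
to its final point. -/
def IsGeodesic (D : M → M → ℝ) {x y : M} (γ : Path x y) : Prop :=
  IsLUB (subdivisionSums D γ) (D x y)

/-- Any two points are joined by a `D`-geodesic. -/
def IsGeodesicSpace (D : M → M → ℝ) : Prop :=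
  ∀ x y : M, ∃ γ : Path x y, IsGeodesic D γ

end Geodesics

/-! ### Two theta-graphs and a rose in rank two -/

theorem fundamentalGroup_eq_range {n : ℕ} (G : MetricGraph) (v : G.V)
    (φ : FreeGroup (Fin n) →* FreeGroup G.E) (ψ : FreeGroup G.E →* FreeGroup (Fin n))
    (r : G.V → FreeGroup G.E) (hv : r v = 1)
    (hφ : ∀ i, φ (FreeGroup.of i) ∈ G.fundamentalGroup v)
    (hr : ∀ e, φ (ψ (FreeGroup.of e)) = (r (G.src e))⁻¹ * FreeGroup.of e * r (G.tgt e)) :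
    φ.range = G.fundamentalGroup v := by
  apply le_antisymm
  · rintro _ ⟨w, rfl⟩
    induction w using FreeGroup.induction_on with
    | C1 => rw [map_one]; exact one_mem _
    | of i => exact hφ i
    | inv_of i h => rw [map_inv]; exact inv_mem h
    | mul a b ha hb => rw [map_mul]; exact mul_mem ha hb
  · rintro _ ⟨p, hp, rfl⟩
    have key : ∀ (p : List (G.E × Bool)) (u w : G.V), G.IsWalk u p w →
        φ (ψ (FreeGroup.mk p)) = (r u)⁻¹ * FreeGroup.mk p * r w := by
      intro p
      induction p with
      | nil =>
        rintro u w rfl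
        rw [← FreeGroup.one_eq_mk]; simp
      | cons x p ih =>
        rintro u w ⟨rfl, h⟩
        have e1 : (FreeGroup.mk (x :: p) : FreeGroup G.E) = FreeGroup.mk [x] * FreeGroup.mk p := by simp
        rw [e1, map_mul, map_mul, ih _ _ h]
        obtain ⟨e, b⟩ := x
        cases b
        · have : (FreeGroup.mk [(e, false)] : FreeGroup G.E) = (FreeGroup.of e)⁻¹ := rfl
          rw [this, map_inv, map_inv, hr]
          simp only [MetricGraph.start, MetricGraph.finish, cond_false]
          group
        · have : (FreeGroup.mk [(e, true)] : FreeGroup G.E) = FreeGroup.of e := rfl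
          rw [this, hr]
          simp only [MetricGraph.start, MetricGraph.finish, cond_true]
          group
    exact ⟨ψ (FreeGroup.mk p), by rw [key p v v hp, hv]; simp⟩

/-- The theta-graph: three edges, of lengths `ℓ 0, ℓ 1, ℓ 2`, from the vertex `false` to the vertex
`true`. -/
def thetaGraph (ℓ : Fin 3 → ℝ) (hℓ : ∀ i, 0 < ℓ i) : MetricGraph where
  V := Bool
  E := Fin 3
  src _ := false
  tgt _ := true
  len := ℓ
  len_pos := hℓ

theorem thetaGraph_connected (ℓ : Fin 3 → ℝ) (hℓ : ∀ i, 0 < ℓ i) :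
    (thetaGraph ℓ hℓ).Connected := by
  intro u w
  cases u <;> cases w
  · exact ⟨[], rfl⟩
  · exact ⟨[((0 : Fin 3), true)], rfl, rfl⟩
  · exact ⟨[((0 : Fin 3), false)], rfl, rfl⟩
  · exact ⟨[], rfl⟩

theorem thetaGraph_valence (ℓ : Fin 3 → ℝ) (hℓ : ∀ i, 0 < ℓ i) (v : Bool) :
    3 ≤ (thetaGraph ℓ hℓ).valence v := by
  have hinj : Function.Injective (fun i : Fin 3 =>
      (⟨(i, !v), by cases v <;> rfl⟩ :
        {x : (thetaGraph ℓ hℓ).E × Bool // (thetaGraph ℓ hℓ).start x = v})) := by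
    intro i j h
    exact congrArg (fun x => x.1.1) h
  have := Nat.card_le_card_of_injective _ hinj
  simpa [MetricGraph.valence] using this

/-- The marking `a ↦ A B⁻¹`, `b ↦ C B⁻¹`, where `A, B, C` are the edges `0, 1, 2`. -/
def markX : FreeGroup (Fin 2) →* FreeGroup (Fin 3) :=
  FreeGroup.lift ![FreeGroup.of 0 * (FreeGroup.of 1)⁻¹, FreeGroup.of 2 * (FreeGroup.of 1)⁻¹]

/-- A left inverse of the marking, collapsing the middle edge. -/
def unmarkX : FreeGroup (Fin 3) →* FreeGroup (Fin 2) :=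
  FreeGroup.lift ![FreeGroup.of 0, 1, FreeGroup.of 1]

theorem unmarkX_markX (w : FreeGroup (Fin 2)) : unmarkX (markX w) = w := by
  have : unmarkX.comp markX = MonoidHom.id _ := by
    ext i
    fin_cases i <;> simp [markX, unmarkX]
  exact DFunLike.congr_fun this w

theorem markX_unmarkX (e : Fin 3) : markX (unmarkX (FreeGroup.of e)) =
    (1 : FreeGroup (Fin 3))⁻¹ * FreeGroup.of e * (FreeGroup.of 1)⁻¹ := by
  fin_cases e <;> simp [markX, unmarkX]

theorem markX_range (ℓ : Fin 3 → ℝ) (hℓ : ∀ i, 0 < ℓ i) :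
    MonoidHom.range (G := FreeGroup (Fin 2)) (N := FreeGroup (thetaGraph ℓ hℓ).E) markX =
      (thetaGraph ℓ hℓ).fundamentalGroup false := by
  refine fundamentalGroup_eq_range (thetaGraph ℓ hℓ) false markX unmarkX
    (fun v => bif v then (FreeGroup.of (1 : Fin 3))⁻¹ else 1) rfl ?_ markX_unmarkX
  intro i
  fin_cases i
  · exact ⟨[((0 : Fin 3), true), ((1 : Fin 3), false)], ⟨rfl, rfl, rfl⟩, by rfl⟩
  · exact ⟨[((2 : Fin 3), true), ((1 : Fin 3), false)], ⟨rfl, rfl, rfl⟩, by rfl⟩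

/-- The first marked theta-graph, with edges `A, B, C` of lengths `ℓ 0, ℓ 1, ℓ 2`, marked by
`a ↦ A B⁻¹`, `b ↦ C B⁻¹`. -/
def thetaX (ℓ : Fin 3 → ℝ) (hℓ : ∀ i, 0 < ℓ i) : MarkedGraph 2 where
  toMetricGraph := thetaGraph ℓ hℓ
  connected := thetaGraph_connected ℓ hℓ
  three_le_valence := thetaGraph_valence ℓ hℓ
  base := false
  marking := markX
  marking_injective := Function.LeftInverse.injective unmarkX_markX
  marking_range := markX_range ℓ hℓ

/-- The marking `a ↦ E F⁻¹`, `b ↦ F G⁻¹`, where `E, F, G` are the edges `0, 1, 2`. -/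
def markY : FreeGroup (Fin 2) →* FreeGroup (Fin 3) :=
  FreeGroup.lift ![FreeGroup.of 0 * (FreeGroup.of 1)⁻¹, FreeGroup.of 1 * (FreeGroup.of 2)⁻¹]

/-- A left inverse of the marking, collapsing the middle edge. -/
def unmarkY : FreeGroup (Fin 3) →* FreeGroup (Fin 2) :=
  FreeGroup.lift ![FreeGroup.of 0, 1, (FreeGroup.of 1)⁻¹]

theorem unmarkY_markY (w : FreeGroup (Fin 2)) : unmarkY (markY w) = w := by
  have : unmarkY.comp markY = MonoidHom.id _ := by
    ext i
    fin_cases i <;> simp [markY, unmarkY]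
  exact DFunLike.congr_fun this w

theorem markY_unmarkY (e : Fin 3) : markY (unmarkY (FreeGroup.of e)) =
    (1 : FreeGroup (Fin 3))⁻¹ * FreeGroup.of e * (FreeGroup.of 1)⁻¹ := by
  fin_cases e <;> simp [markY, unmarkY]

theorem markY_range (ℓ : Fin 3 → ℝ) (hℓ : ∀ i, 0 < ℓ i) :
    MonoidHom.range (G := FreeGroup (Fin 2)) (N := FreeGroup (thetaGraph ℓ hℓ).E) markY =
      (thetaGraph ℓ hℓ).fundamentalGroup false := by
  refine fundamentalGroup_eq_range (thetaGraph ℓ hℓ) false markY unmarkY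
    (fun v => bif v then (FreeGroup.of (1 : Fin 3))⁻¹ else 1) rfl ?_ markY_unmarkY
  intro i
  fin_cases i
  · exact ⟨[((0 : Fin 3), true), ((1 : Fin 3), false)], ⟨rfl, rfl, rfl⟩, by rfl⟩
  · exact ⟨[((1 : Fin 3), true), ((2 : Fin 3), false)], ⟨rfl, rfl, rfl⟩, by rfl⟩

/-- The second marked theta-graph, with edges `E, F, G` of lengths `ℓ 0, ℓ 1, ℓ 2`, marked by
`a ↦ E F⁻¹`, `b ↦ F G⁻¹`. -/
def thetaY (ℓ : Fin 3 → ℝ) (hℓ : ∀ i, 0 < ℓ i) : MarkedGraph 2 where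
  toMetricGraph := thetaGraph ℓ hℓ
  connected := thetaGraph_connected ℓ hℓ
  three_le_valence := thetaGraph_valence ℓ hℓ
  base := false
  marking := markY
  marking_injective := Function.LeftInverse.injective unmarkY_markY
  marking_range := markY_range ℓ hℓ

/-- The rose with two petals, of lengths `ℓ 0` and `ℓ 1`. -/
def roseGraph (ℓ : Fin 2 → ℝ) (hℓ : ∀ i, 0 < ℓ i) : MetricGraph where
  V := Unit
  E := Fin 2
  src _ := ()
  tgt _ := ()
  len := ℓ
  len_pos := hℓ

/-- The rose with two petals and the identical marking: `a` and `b` are the petals of lengths `ℓ 0`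
and `ℓ 1`. -/
def rose (ℓ : Fin 2 → ℝ) (hℓ : ∀ i, 0 < ℓ i) : MarkedGraph 2 where
  toMetricGraph := roseGraph ℓ hℓ
  connected _ _ := ⟨[], rfl⟩
  three_le_valence _ := by
    have hinj : Function.Injective (fun x : Fin 2 × Bool =>
        (⟨x, rfl⟩ : {x : (roseGraph ℓ hℓ).E × Bool // (roseGraph ℓ hℓ).start x = ()})) := by
      intro i j h
      exact congrArg Subtype.val h
    have := Nat.card_le_card_of_injective _ hinj
    simp only [Nat.card_eq_fintype_card, Fintype.card_prod, Fintype.card_fin,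
      Fintype.card_bool] at this
    exact le_trans (by norm_num) this
  base := ()
  marking := MonoidHom.id _
  marking_injective := Function.injective_id
  marking_range := by
    refine fundamentalGroup_eq_range (roseGraph ℓ hℓ) () _ (MonoidHom.id _) (fun _ => 1) rfl ?_ ?_
    · intro i
      exact ⟨[(i, true)], ⟨rfl, rfl⟩, rfl⟩
    · intro e
      simp
      rfl

/-- The open simplex of the first marked theta-graph. -/
def simplexX : Set (CV 2) := {Z | ∃ ℓ hℓ, Z = CV.of (thetaX ℓ hℓ)}

/-- The open simplex of the second marked theta-graph. -/
def simplexY : Set (CV 2) := {Z | ∃ ℓ hℓ, Z = CV.of (thetaY ℓ hℓ)}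

/-- The point `T_α`: the petal `a` has length `α` and the petal `b` has length `1 - α`. -/
def T (α : Set.Ioo (0 : ℝ) 1) : CV 2 :=
  CV.of (rose ![α, 1 - α] (by
    intro i
    have := α.2.1
    have := α.2.2
    fin_cases i <;> simp_all))

/-- The point `X`: edge lengths `A = 1/6`, `B = 1/3`, `C = 1/2`. -/
noncomputable def X : CV 2 :=
  CV.of (thetaX ![1 / 6, 1 / 3, 1 / 2] (by intro i; fin_cases i <;> norm_num))

/-- The point `Y`: edge lengths `E = 1/2`, `F = 1/3`, `G = 1/6`. -/
noncomputable def Y : CV 2 :=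
  CV.of (thetaY ![1 / 2, 1 / 3, 1 / 6] (by intro i; fin_cases i <;> norm_num))

end OuterSpaceMetric

namespace OuterSpaceMetric

/-! ### Edge paths and words -/

/-! From `X` to `Y` the length of `ab⁻¹` doubles (2/3 to 4/3) and that of `ab` is halved, and
explicit maps between the two graphs show that no word does worse (`stretchR_X_Y_le`,
`stretchL_X_Y_le`). A geodesic through a point `Z` makes the stretch factors multiply without loss
(`IsGeodesic.add_le`), so these words must be stretched optimally on both legs, and this leaves
little room for the other words.

A path from `X` to `Y` passes through a point `Z` where `ab` and `ab⁻¹` have the same length `c`.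
For `d_R`, the ratio of `ab⁻¹` from `X` to `Z`, combined with the ratios of `a` and `b` from `Z` to
`Y`, bounds `a` below by `5c/8` and `b` by `3c/8`. On the rose `T_α`, where `c = 1`, this forces `α
= 5/8`. For `d_L` the roles of `a` and `b` are exchanged and `α = 3/8`. A `d`-geodesic must lose
nothing in either factor, so `a` and `b` are both at least `5c/8`. But their sum is at most `c` by
`le_length_mul_or`: contradiction (`not_exists_d_geodesic`). This last argument uses only the words
`a`, `b`, `ab`, `ab⁻¹` and the bound 2 on both factors, so it applies in every rank once edges are
added that are stretched by less than 2.

The combinatorial input is that a cyclically reduced closed edge path realises the translation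
length, together with the alternative `pair_cases` for two elements: either the axes are disjoint,
and both products have the same length, exceeding the sum, or there are cyclically reduced loops
with a common base point. From it follows that the points with `l(ab) = l(ab⁻¹) = l(a) + l(b)` are
the roses `T_α` (`exists_eq_T`), which gives both the common edge of the closures and the crossing
statement `path_meets_edge`. -/

theorem isReduced_invRev {α : Type*} {p : List (α × Bool)} (h : FreeGroup.IsReduced p) :
    FreeGroup.IsReduced (FreeGroup.invRev p) := by
  classical
  rw [FreeGroup.isReduced_iff_reduce_eq, FreeGroup.reduce_invRev, h.reduce_eq]

theorem isCyclicallyReduced_invRev {α : Type*} {p : List (α × Bool)}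
    (h : FreeGroup.IsCyclicallyReduced p) : FreeGroup.IsCyclicallyReduced (FreeGroup.invRev p) := by
  refine ⟨isReduced_invRev h.1, fun a ha b hb hab => ?_⟩
  have h2 := h.2
  simp only [FreeGroup.invRev, List.getLast?_reverse, List.head?_reverse, List.head?_map,
    List.getLast?_map, Option.mem_def, Option.map_eq_some_iff] at ha hb
  obtain ⟨a', ha', rfl⟩ := ha
  obtain ⟨b', hb', rfl⟩ := hb
  simp [h2 b' hb' a' ha' hab.symm]

namespace MetricGraph

variable {G : MetricGraph}

@[simp] theorem pathLength_nil : G.pathLength [] = 0 := rfl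

@[simp] theorem pathLength_cons (x : G.E × Bool) (p : List (G.E × Bool)) :
    G.pathLength (x :: p) = G.len x.1 + G.pathLength p := by simp [pathLength]

@[simp] theorem pathLength_append (p q : List (G.E × Bool)) :
    G.pathLength (p ++ q) = G.pathLength p + G.pathLength q := by simp [pathLength]

@[simp] theorem pathLength_invRev (p : List (G.E × Bool)) :
    G.pathLength (FreeGroup.invRev p) = G.pathLength p := by
  simp [pathLength, FreeGroup.invRev, Function.comp_def]

theorem pathLength_flatten_replicate (k : ℕ) (p : List (G.E × Bool)) :
    G.pathLength (List.replicate k p).flatten = k * G.pathLength p := by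
  induction k with
  | zero => simp
  | succ k ih => rw [List.replicate_succ, List.flatten_cons, pathLength_append, ih]; push_cast; ring

theorem pathLength_nonneg (p : List (G.E × Bool)) : 0 ≤ G.pathLength p := by
  induction p with
  | nil => simp
  | cons x p ih => rw [pathLength_cons]; exact add_nonneg (G.len_pos _).le ih

theorem pathLength_pos {p : List (G.E × Bool)} (hp : p ≠ []) : 0 < G.pathLength p := by
  cases p with
  | nil => exact absurd rfl hp
  | cons x p => rw [pathLength_cons]; exact add_pos_of_pos_of_nonneg (G.len_pos _) (pathLength_nonneg p)

theorem pathLength_le_of_sublist {p q : List (G.E × Bool)} (h : p.Sublist q) :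
    G.pathLength p ≤ G.pathLength q := by
  induction h with
  | slnil => rfl
  | cons x _ ih => rw [pathLength_cons]; linarith [G.len_pos x.1]
  | cons_cons x _ ih => rw [pathLength_cons, pathLength_cons]; linarith

/-- Free reduction only deletes letters, so the reduced form is a sublist of any word with the same
class. -/
theorem pathLength_le_of_isReduced {p q : List (G.E × Bool)} (hp : FreeGroup.IsReduced p)
    (h : FreeGroup.mk p = FreeGroup.mk q) : G.pathLength p ≤ G.pathLength q := by
  classical
  have h1 := FreeGroup.reduce.sound h
  rw [hp.reduce_eq] at h1
  rw [h1]
  exact pathLength_le_of_sublist FreeGroup.reduce.red.sublist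

/-- A cyclically reduced word is shortest in its conjugacy class. -/
theorem pathLength_le_of_isCyclicallyReduced {p q : List (G.E × Bool)}
    (hp : FreeGroup.IsCyclicallyReduced p) (c : FreeGroup G.E)
    (h : FreeGroup.mk p = c * FreeGroup.mk q * c⁻¹) : G.pathLength p ≤ G.pathLength q := by
  obtain ⟨c, rfl⟩ := Quot.exists_rep c
  change FreeGroup.mk p = FreeGroup.mk c * FreeGroup.mk q * (FreeGroup.mk c)⁻¹ at h
  -- Powers of `p` stay reduced, while conjugation costs `2 * |c|` once, independently of `k`.
  -- Dividing by a large `k` removes this error term.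
  have key : ∀ k : ℕ, k * G.pathLength p ≤ k * G.pathLength q + 2 * G.pathLength c := by
    intro k
    have h1 : FreeGroup.mk p ^ k = FreeGroup.mk c * FreeGroup.mk q ^ k * (FreeGroup.mk c)⁻¹ := by
      rw [h, conj_pow]
    rw [FreeGroup.pow_mk, FreeGroup.pow_mk, FreeGroup.inv_mk, FreeGroup.mul_mk,
      FreeGroup.mul_mk] at h1
    have h2 := pathLength_le_of_isReduced (hp.flatten_replicate k).1 h1
    simp only [pathLength_append, pathLength_flatten_replicate, pathLength_invRev] at h2
    linarith
  by_contra! hlt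
  obtain ⟨k, hk⟩ := exists_nat_gt (2 * G.pathLength c / (G.pathLength p - G.pathLength q))
  rw [div_lt_iff₀ (by linarith)] at hk
  linarith [key k]

theorem isWalk_append_iff {u w : G.V} {p q : List (G.E × Bool)} :
    G.IsWalk u (p ++ q) w ↔ ∃ v, G.IsWalk u p v ∧ G.IsWalk v q w := by
  induction p generalizing u with
  | nil => simp [IsWalk]
  | cons x p ih => simp [IsWalk, ih, and_assoc]

theorem finish_not (x : G.E) (b : Bool) : G.finish (x, !b) = G.start (x, b) := by
  cases b <;> rfl

theorem IsWalk.red {u w : G.V} {p q : List (G.E × Bool)} (h : FreeGroup.Red p q)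
    (hp : G.IsWalk u p w) : G.IsWalk u q w := by
  induction h with
  | refl => exact hp
  | tail _ h ih =>
    obtain @⟨L₁, L₂, x, b⟩ := h
    obtain ⟨v, h1, h2⟩ := isWalk_append_iff.1 ih
    simp only [IsWalk, finish_not] at h2
    exact isWalk_append_iff.2 ⟨v, h1, h2.1 ▸ h2.2.2⟩

theorem IsWalk.finish_unique {u w w' : G.V} {p : List (G.E × Bool)} (h : G.IsWalk u p w)
    (h' : G.IsWalk u p w') : w = w' := by
  induction p generalizing u with
  | nil => exact h.symm.trans h'
  | cons x p ih => exact ih h.2 h'.2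

theorem isWalk_invRev_iff {u w : G.V} {p : List (G.E × Bool)} :
    G.IsWalk u (FreeGroup.invRev p) w ↔ G.IsWalk w p u :=
  ⟨fun h => by simpa using h.invRev, fun h => h.invRev⟩

/-- Every closed edge path is freely homotopic to a cyclically reduced one. -/
theorem exists_isCyclicallyReduced {u : G.V} {p : List (G.E × Bool)} (hp : G.IsWalk u p u) :
    ∃ v c q, G.IsWalk u c v ∧ G.IsWalk v q v ∧ FreeGroup.IsCyclicallyReduced q ∧
      FreeGroup.IsReduced (c ++ q ++ FreeGroup.invRev c) ∧
      FreeGroup.mk p = FreeGroup.mk (c ++ q ++ FreeGroup.invRev c) := by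
  classical
  have hr : FreeGroup.IsReduced (FreeGroup.reduce p) :=
    FreeGroup.isReduced_iff_reduce_eq.2 FreeGroup.reduce.idem
  have hw : G.IsWalk u (FreeGroup.reduce p) u := hp.red FreeGroup.reduce.red
  have e := FreeGroup.reduceCyclically.conj_conjugator_reduceCyclically (FreeGroup.reduce p)
  have hm : FreeGroup.mk p = FreeGroup.mk (FreeGroup.reduce p) := FreeGroup.reduce.self.symm
  rw [← e] at hw hm hr
  obtain ⟨v, h1, h2⟩ := isWalk_append_iff.1 hw
  obtain ⟨v', h3, h4⟩ := isWalk_append_iff.1 h1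
  have hv : v = v' := (isWalk_invRev_iff.1 h2).finish_unique h3
  subst hv
  exact ⟨v, _, _, h3, h4, FreeGroup.reduceCyclically.isCyclicallyReduced
    (FreeGroup.isReduced_iff_reduce_eq.2 FreeGroup.reduce.idem), hr, hm⟩

/-- A cancellation, inside the word or across its ends, removes edges of positive length. Hence a
shortest path admits neither. -/
theorem isCyclicallyReduced_of_forall_le {u : G.V} {p : List (G.E × Bool)} (hp : G.IsWalk u p u)
    (h : ∀ v c q, G.IsWalk u c v → G.IsWalk v q v →
      FreeGroup.mk p = FreeGroup.mk c * FreeGroup.mk q * (FreeGroup.mk c)⁻¹ →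
      G.pathLength p ≤ G.pathLength q) : FreeGroup.IsCyclicallyReduced p := by
  classical
  have hr := FreeGroup.reduce.red (L := p)
  have hm : FreeGroup.mk p = FreeGroup.mk (FreeGroup.reduce p) := FreeGroup.reduce.self.symm
  have hw : G.IsWalk u (FreeGroup.reduce p) u := hp.red hr
  have e1 : FreeGroup.reduce p = p := by
    have h1 := h u [] (FreeGroup.reduce p) rfl hw (by
      rw [← FreeGroup.one_eq_mk, one_mul, inv_one, mul_one]; exact hm)
    obtain ⟨n, hn⟩ := hr.length
    by_contra hne
    obtain ⟨l, hl⟩ := hr.sublist.exists_perm_append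
    have h2 : G.pathLength p = G.pathLength (FreeGroup.reduce p) + G.pathLength l := by
      rw [← pathLength_append]
      exact (hl.map _).sum_eq
    have hl' : l ≠ [] := by
      rintro rfl
      have := hl.length_eq
      simp only [List.append_nil] at this
      exact hne (hr.sublist.eq_of_length this.symm)
    linarith [pathLength_pos hl']
  have hred : FreeGroup.IsReduced p := FreeGroup.isReduced_iff_reduce_eq.2 e1
  have e := FreeGroup.reduceCyclically.conj_conjugator_reduceCyclically p
  have hc := FreeGroup.reduceCyclically.isCyclicallyReduced hred
  rw [e1, ← e] at hw
  obtain ⟨v, h1, h2⟩ := isWalk_append_iff.1 hw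
  obtain ⟨v', h3, h4⟩ := isWalk_append_iff.1 h1
  have hv : v = v' := (isWalk_invRev_iff.1 h2).finish_unique h3
  subst hv
  have h5 := h v _ _ h3 h4 (by rw [FreeGroup.inv_mk, FreeGroup.mul_mk, FreeGroup.mul_mk, e])
  have h6 : G.pathLength p = _ := congrArg G.pathLength e.symm
  simp only [pathLength_append, pathLength_invRev] at h6
  have h7 : FreeGroup.reduceCyclically.conjugator p = [] := by
    by_contra hne
    linarith [pathLength_pos hne]
  rw [h7] at e
  simp only [List.nil_append, FreeGroup.invRev_empty, List.append_nil] at e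
  rwa [e] at hc

end MetricGraph

/-! ### Translation lengths and cyclically reduced representatives. -/

namespace MarkedGraph

open MetricGraph

variable {n : ℕ} (A : MarkedGraph n)

/-- The closed edge path `p` at `u` is freely homotopic to the loop `w`, along the path `c` from
the base point. -/
structure Represents (w : FreeGroup (Fin n)) (u : A.V) (c p : List (A.E × Bool)) : Prop where
  walk : A.IsWalk A.base c u
  closed : A.IsWalk u p u
  eq : A.marking w = FreeGroup.mk c * FreeGroup.mk p * (FreeGroup.mk c)⁻¹

variable {A} {w : FreeGroup (Fin n)} {u : A.V} {c p : List (A.E × Bool)}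

theorem Represents.length_le (h : A.Represents w u c p) : A.length w ≤ A.pathLength p :=
  csInf_le ⟨0, A.loopLengths_nonneg w⟩ ⟨u, p, c, h.walk, h.closed, h.eq, rfl⟩

/-- A cyclically reduced representative realises the translation length. -/
theorem Represents.length_eq (h : A.Represents w u c p) (hp : FreeGroup.IsCyclicallyReduced p) :
    A.length w = A.pathLength p := by
  refine le_antisymm h.length_le (le_csInf (A.loopLengths_nonempty w) ?_)
  rintro _ ⟨u', p', c', -, -, e, rfl⟩
  refine pathLength_le_of_isCyclicallyReduced hp ((FreeGroup.mk c)⁻¹ * FreeGroup.mk c') ?_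
  have e1 := h.eq
  have : FreeGroup.mk p = (FreeGroup.mk c)⁻¹ * A.marking w * FreeGroup.mk c := by rw [e1]; group
  rw [this, e]
  group

/-- This converse of `Represents.length_eq` turns an equality between translation lengths into the
absence of cancellation. -/
theorem Represents.isCyclicallyReduced (h : A.Represents w u c p)
    (hp : A.pathLength p ≤ A.length w) : FreeGroup.IsCyclicallyReduced p := by
  refine isCyclicallyReduced_of_forall_le h.closed fun v d q hd hq e => hp.trans ?_
  refine Represents.length_le (u := v) (c := c ++ d) ⟨h.walk.append hd, hq, ?_⟩
  rw [h.eq, e, ← FreeGroup.mul_mk]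
  group

variable (A) in
theorem exists_represents (w : FreeGroup (Fin n)) :
    ∃ u c p, A.Represents w u c p ∧ FreeGroup.IsCyclicallyReduced p := by
  have hm : A.marking w ∈ A.fundamentalGroup A.base := A.marking_range ▸ ⟨w, rfl⟩
  obtain ⟨p, hp, e⟩ := hm
  obtain ⟨u, c, q, h1, h2, h3, -, h4⟩ := exists_isCyclicallyReduced hp
  refine ⟨u, c, q, ⟨h1, h2, ?_⟩, h3⟩
  rw [← e, h4, FreeGroup.inv_mk, FreeGroup.mul_mk, FreeGroup.mul_mk]

theorem Represents.ne_nil (h : A.Represents w u c p) (hw : w ≠ 1) : p ≠ [] := by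
  rintro rfl
  apply hw
  apply A.marking_injective
  rw [h.eq, map_one, ← FreeGroup.one_eq_mk, mul_one, mul_inv_cancel]

variable (A) in
theorem length_pos (hw : w ≠ 1) : 0 < A.length w := by
  obtain ⟨u, c, p, h, hp⟩ := A.exists_represents w
  rw [h.length_eq hp]
  exact pathLength_pos (h.ne_nil hw)

end MarkedGraph

/-! ### Pairs of loops -/

/-- The condition at the junction is that the two directions leaving it, back along `p` and forward
along `q`, differ. Stated by first letters, it allows the directions at a vertex to be compared. -/
theorem isReduced_append_iff {α : Type*} {p q : List (α × Bool)} :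
    FreeGroup.IsReduced (p ++ q) ↔ FreeGroup.IsReduced p ∧ FreeGroup.IsReduced q ∧
      ∀ z ∈ (FreeGroup.invRev p).head?, z ∉ q.head? := by
  rw [FreeGroup.IsReduced, List.isChain_append]
  refine and_congr_right fun _ => and_congr_right fun _ => ?_
  simp only [FreeGroup.invRev, List.head?_reverse, List.getLast?_map, Option.mem_def,
    Option.map_eq_some_iff]
  constructor
  · rintro h _ ⟨a, ha, rfl⟩ hb
    simpa using h a ha _ hb
  · rintro h a ha ⟨b, s⟩ hb rfl
    by_contra hne
    refine h _ ⟨a, ha, rfl⟩ ?_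
    rw [hb]
    congr 2
    revert hne
    cases a.2 <;> cases s <;> simp

/-- The condition on the two ends of `p` is the junction condition of `p ++ p`. -/
theorem isCyclicallyReduced_iff_head {α : Type*} {p : List (α × Bool)} :
    FreeGroup.IsCyclicallyReduced p ↔ FreeGroup.IsReduced p ∧
      ∀ z ∈ (FreeGroup.invRev p).head?, z ∉ p.head? := by
  have h1 := isReduced_append_iff (p := p) (q := p)
  rw [FreeGroup.IsReduced, List.isChain_append] at h1
  have h2 : ∀ P Q R : Prop, (P ∧ P ∧ Q ↔ P ∧ P ∧ R) → (P ∧ Q ↔ P ∧ R) := by tauto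
  exact h2 _ _ _ h1

/-- The square of a cyclically reduced word is reduced, and it contains the rotated word as an
infix. -/
theorem isCyclicallyReduced_rotate {α : Type*} {z : α × Bool} {p : List (α × Bool)}
    (h : FreeGroup.IsCyclicallyReduced (z :: p)) : FreeGroup.IsCyclicallyReduced (p ++ [z]) := by
  have h1 : FreeGroup.IsReduced (z :: p ++ z :: p) := by
    simpa using (h.flatten_replicate 2).1
  have h3 : FreeGroup.IsReduced (p ++ [z]) := h1.infix ⟨[z], p, by simp⟩
  refine ⟨h3, fun a ha b hb => ?_⟩
  simp only [List.getLast?_append, List.getLast?_singleton, Option.some_or, Option.mem_def,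
    Option.some.injEq] at ha
  subst ha
  cases p with
  | nil => simp_all
  | cons y p =>
    simp only [List.cons_append, List.head?_cons, Option.mem_def, Option.some.injEq] at hb
    subst hb
    exact (FreeGroup.isReduced_cons_cons.1 h.1).1

/-- The product of a loop `G` and a loop `H` at the end of an arc `q` meeting `G` only in its
initial point. -/
theorem isCyclicallyReduced_barbell {α : Type*} {G q H : List (α × Bool)} (hG : G ≠ [])
    (hq : q ≠ []) (hH : H ≠ []) (h1 : FreeGroup.IsReduced (G ++ q))
    (h2 : FreeGroup.IsReduced (FreeGroup.invRev G ++ q))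
    (h3 : FreeGroup.IsReduced (q ++ H ++ FreeGroup.invRev q)) :
    FreeGroup.IsCyclicallyReduced (FreeGroup.invRev q ++ G ++ q ++ H) := by
  have h4 : FreeGroup.IsReduced (FreeGroup.invRev q ++ G) := by
    simpa using isReduced_invRev h2
  have h5 : FreeGroup.IsReduced (q ++ H) := h3.infix ⟨[], FreeGroup.invRev q, by simp⟩
  have h6 : FreeGroup.IsReduced (H ++ FreeGroup.invRev q) := h3.infix ⟨q, [], by simp⟩
  have h7 : FreeGroup.IsReduced (FreeGroup.invRev q ++ G ++ q ++ H) :=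
    (h4.append_overlap h1 hG).append_overlap h5 hq
  refine isCyclicallyReduced_iff_head.2 ⟨h7, fun z hz hz' => ?_⟩
  have hq' : FreeGroup.invRev q ≠ [] := by
    rintro h
    exact hq (FreeGroup.invRev_injective (by simpa using h))
  have hH' : FreeGroup.invRev H ≠ [] := by
    rintro h
    exact hH (FreeGroup.invRev_injective (by simpa using h))
  refine (isReduced_append_iff.1 h6).2.2 z ?_ ?_
  · rw [FreeGroup.invRev_append, List.head?_append_of_ne_nil _ hH'] at hz
    exact hz
  · rw [List.append_assoc, List.append_assoc, List.head?_append_of_ne_nil _ hq'] at hz'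
    exact hz'

theorem invRev_ne_nil {α : Type*} {p : List (α × Bool)} (h : p ≠ []) :
    FreeGroup.invRev p ≠ [] := fun h' =>
  h (FreeGroup.invRev_injective (by simpa using h'))

theorem isCyclicallyReduced_append_iff {α : Type*} {G H : List (α × Bool)} (hG : G ≠ [])
    (hH : H ≠ []) (h1 : FreeGroup.IsReduced G) (h2 : FreeGroup.IsReduced H) :
    FreeGroup.IsCyclicallyReduced (G ++ H) ↔ (FreeGroup.invRev G).head? ≠ H.head? ∧
      (FreeGroup.invRev H).head? ≠ G.head? := by
  rw [isCyclicallyReduced_iff_head, isReduced_append_iff, FreeGroup.invRev_append,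
    List.head?_append_of_ne_nil _ (invRev_ne_nil hH), List.head?_append_of_ne_nil _ hG]
  obtain ⟨a, G', e1⟩ := List.exists_cons_of_ne_nil (invRev_ne_nil hG)
  obtain ⟨b, H', e2⟩ := List.exists_cons_of_ne_nil (invRev_ne_nil hH)
  rw [e1, e2]
  simp [h1, h2, eq_comm]

/-- Let `a, a'` be the directions in which `G` leaves and `invRev G` leaves, and `b, b'` those for
`H`. Then `a ≠ a'` and `b ≠ b'`. The first product fails only if `a' = b` or `b' = a`, the second
only if `a' = b'` or `b = a`. Any combination of the two failures identifies `a` with `a'` or `b`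
with `b'`. -/
theorem isCyclicallyReduced_append_or {α : Type*} {G H : List (α × Bool)} (hG : G ≠ [])
    (hH : H ≠ []) (h1 : FreeGroup.IsCyclicallyReduced G) (h2 : FreeGroup.IsCyclicallyReduced H) :
    FreeGroup.IsCyclicallyReduced (G ++ H) ∨
      FreeGroup.IsCyclicallyReduced (G ++ FreeGroup.invRev H) := by
  rw [isCyclicallyReduced_append_iff hG hH h1.1 h2.1,
    isCyclicallyReduced_append_iff hG (invRev_ne_nil hH) h1.1 (isReduced_invRev h2.1),
    FreeGroup.invRev_invRev]
  have h3 := (isCyclicallyReduced_iff_head.1 h1).2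
  have h4 := (isCyclicallyReduced_iff_head.1 h2).2
  obtain ⟨a, G', e1⟩ := List.exists_cons_of_ne_nil hG
  obtain ⟨b, H', e2⟩ := List.exists_cons_of_ne_nil hH
  obtain ⟨a', G'', e3⟩ := List.exists_cons_of_ne_nil (invRev_ne_nil hG)
  obtain ⟨b', H'', e4⟩ := List.exists_cons_of_ne_nil (invRev_ne_nil hH)
  rw [e3, e1] at h3
  rw [e4, e2] at h4
  rw [e3, e4, e1, e2]
  simp only [List.head?_cons, Option.mem_def, Option.some.injEq, forall_eq', ne_eq] at *
  grind

namespace MarkedGraph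

open MetricGraph

variable {n : ℕ} {A : MarkedGraph n} {x y : FreeGroup (Fin n)} {u : A.V}
  {c p q G H : List (A.E × Bool)}

theorem Represents.inv (h : A.Represents x u c p) : A.Represents x⁻¹ u c (FreeGroup.invRev p) :=
  ⟨h.walk, h.closed.invRev, by rw [map_inv, h.eq, ← FreeGroup.inv_mk]; group⟩

theorem Represents.mul (h : A.Represents x u c p) (h' : A.Represents y u c q) :
    A.Represents (x * y) u c (p ++ q) :=
  ⟨h.walk, h.closed.append h'.closed, by rw [map_mul, h.eq, h'.eq, ← FreeGroup.mul_mk]; group⟩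

theorem Represents.shift {d : List (A.E × Bool)} {v : A.V} (h : A.Represents x u c p)
    (hd : A.IsWalk u d v) : A.Represents x v (c ++ d) (FreeGroup.invRev d ++ p ++ d) :=
  ⟨h.walk.append hd, (hd.invRev.append h.closed).append hd, by
    rw [h.eq]; simp only [← FreeGroup.mul_mk, ← FreeGroup.inv_mk]; group⟩

theorem Represents.congr (h : A.Represents x u c p) (hq : A.IsWalk u q u)
    (e : FreeGroup.mk p = FreeGroup.mk q) : A.Represents x u c q :=
  ⟨h.walk, hq, e ▸ h.eq⟩

theorem Represents.rotate {z : A.E × Bool} (h : A.Represents x u c (z :: p)) :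
    A.Represents x (A.finish z) (c ++ [z]) (p ++ [z]) := by
  have hz : A.IsWalk u [z] (A.finish z) := ⟨h.closed.1, rfl⟩
  refine (h.shift hz).congr (isWalk_append_iff.2 ⟨u, h.closed.2, hz⟩) ?_
  have e : (FreeGroup.mk (z :: p) : FreeGroup A.E) = FreeGroup.mk [z] * FreeGroup.mk p := by simp
  simp only [← FreeGroup.mul_mk, ← FreeGroup.inv_mk, e]
  group

theorem length_inv (x : FreeGroup (Fin n)) : A.length x⁻¹ = A.length x := by
  obtain ⟨u, c, p, h, hp⟩ := A.exists_represents x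
  rw [h.length_eq hp, h.inv.length_eq (isCyclicallyReduced_invRev hp), pathLength_invRev]

/-- Induction on the length of the arc `q` from the loop `G` to the loop `H`. If `q` leaves `G` in a
new direction, then both products are barbells of length `l(x) + l(y) + 2 * |q|`. Otherwise `G` is
rotated along the first edge of `q`, and the arc gets shorter. -/
theorem pair_cases_aux (m : ℕ) : ∀ {u v : A.V} {c G q H : List (A.E × Bool)}, q.length = m →
    A.Represents x u c G → FreeGroup.IsCyclicallyReduced G → G ≠ [] → A.IsWalk u q v →
    A.Represents y v (c ++ q) H → FreeGroup.IsCyclicallyReduced H → H ≠ [] →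
    FreeGroup.IsReduced (q ++ H ++ FreeGroup.invRev q) →
    (A.length (x * y) = A.length (x * y⁻¹) ∧ A.length x + A.length y < A.length (x * y)) ∨
      ∃ u c G H, A.Represents x u c G ∧ A.Represents y u c H ∧
        FreeGroup.IsCyclicallyReduced G ∧ FreeGroup.IsCyclicallyReduced H := by
  induction m with
  | zero =>
    intro u v c G q H hm hG hGc _ hq hH hHc _ _
    obtain rfl := List.length_eq_zero_iff.1 hm
    obtain rfl : u = v := hq
    rw [List.append_nil] at hH
    exact Or.inr ⟨u, c, G, H, hG, hH, hGc, hHc⟩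
  | succ m ih =>
    intro u v c G q H hm hG hGc hGn hq hH hHc hHn hr
    obtain ⟨z, q, rfl⟩ := List.exists_cons_of_length_eq_add_one hm
    have hz : A.start z = u := hq.1
    have step : ∀ {G'}, A.Represents x (A.finish z) (c ++ [z]) G' →
        FreeGroup.IsCyclicallyReduced G' → G' ≠ [] → (A.length (x * y) = A.length (x * y⁻¹) ∧
          A.length x + A.length y < A.length (x * y)) ∨ ∃ u c G H, A.Represents x u c G ∧
          A.Represents y u c H ∧ FreeGroup.IsCyclicallyReduced G ∧
          FreeGroup.IsCyclicallyReduced H := by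
      intro G' h1 h2 h3
      refine ih (by simpa using hm) h1 h2 h3 hq.2 (by simpa using hH) hHc hHn
        (hr.infix ⟨[z], FreeGroup.invRev [z], ?_⟩)
      rw [FreeGroup.invRev_cons (a := z) (L := q)]
      simp
    by_cases h1 : FreeGroup.IsReduced (G ++ z :: q)
    · by_cases h2 : FreeGroup.IsReduced (FreeGroup.invRev G ++ z :: q)
      · left
        have c1 := isCyclicallyReduced_barbell hGn (List.cons_ne_nil _ _) hHn h1 h2 hr
        have hr' : FreeGroup.IsReduced (z :: q ++ FreeGroup.invRev H ++
            FreeGroup.invRev (z :: q)) := by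
          have := isReduced_invRev hr
          rwa [FreeGroup.invRev_append, FreeGroup.invRev_append, FreeGroup.invRev_invRev,
            ← List.append_assoc] at this
        have c2 := isCyclicallyReduced_barbell hGn (List.cons_ne_nil _ _) (invRev_ne_nil hHn)
          h1 h2 hr'
        have e1 := ((hG.shift hq).mul hH).length_eq c1
        have e2 := ((hG.shift hq).mul hH.inv).length_eq c2
        have e3 : 0 < A.pathLength (z :: q) := pathLength_pos (List.cons_ne_nil _ _)
        rw [e1, e2, hG.length_eq hGc, hH.length_eq hHc]
        simp only [pathLength_append, pathLength_invRev]
        exact ⟨trivial, by linarith⟩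
      · obtain ⟨z', G', e⟩ := List.exists_cons_of_ne_nil hGn
        subst e
        have : z = z' := by
          by_contra hne
          refine h2 (isReduced_append_iff.2 ⟨isReduced_invRev hGc.1,
            hr.infix ⟨[], H ++ FreeGroup.invRev (z :: q), by simp⟩, ?_⟩)
          simpa using hne
        subst this
        exact step hG.rotate (isCyclicallyReduced_rotate hGc) (by simp)
    -- Here the arc runs backwards along the end of `G`, so the inverse loop is the one to rotate.
    · obtain ⟨z', G', e⟩ := List.exists_cons_of_ne_nil (invRev_ne_nil hGn)
      have : z = z' := by
        by_contra hne
        refine h1 (isReduced_append_iff.2 ⟨hGc.1,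
          hr.infix ⟨[], H ++ FreeGroup.invRev (z :: q), by simp⟩, ?_⟩)
        rw [e]
        simpa using hne
      subst this
      have h3 := hG.inv
      have h4 := isCyclicallyReduced_invRev hGc
      rw [e] at h3 h4
      have h5 := h3.rotate.inv
      rw [inv_inv] at h5
      exact step h5 (isCyclicallyReduced_invRev (isCyclicallyReduced_rotate h4))
        (invRev_ne_nil (by simp))

/-- Either the axes of `x` and `y` are disjoint, or `x` and `y` are represented by cyclically
reduced loops with the same base point. -/
theorem pair_cases (hx : x ≠ 1) (hy : y ≠ 1) :
    (A.length (x * y) = A.length (x * y⁻¹) ∧ A.length x + A.length y < A.length (x * y)) ∨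
      ∃ u c G H, A.Represents x u c G ∧ A.Represents y u c H ∧
        FreeGroup.IsCyclicallyReduced G ∧ FreeGroup.IsCyclicallyReduced H := by
  obtain ⟨u, c, G, hG, hGc⟩ := A.exists_represents x
  obtain ⟨u', c', H', hH', -⟩ := A.exists_represents y
  -- A loop for `y` is carried to the base point of `G`. Its cyclic reduction then supplies the arc
  -- `q` as the conjugating path.
  have hw : A.IsWalk u (FreeGroup.invRev c ++ c' ++ H' ++ FreeGroup.invRev c' ++ c) u :=
    (((hG.walk.invRev.append hH'.walk).append hH'.closed).append hH'.walk.invRev).append hG.walk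
  obtain ⟨v, q, H, h1, h2, h3, h4, h5⟩ := exists_isCyclicallyReduced hw
  have hH : A.Represents y v (c ++ q) H := by
    refine ⟨hG.walk.append h1, h2, ?_⟩
    simp only [← FreeGroup.mul_mk, ← FreeGroup.inv_mk] at h5 ⊢
    have e : FreeGroup.mk c * (FreeGroup.mk q * FreeGroup.mk H * (FreeGroup.mk q)⁻¹) *
      (FreeGroup.mk c)⁻¹ = A.marking y := by
      rw [← h5, hH'.eq]; group
    rw [← e]; group
  exact pair_cases_aux _ rfl hG hGc (hG.ne_nil hx) h1 hH h3 (hH.ne_nil hy) h4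

theorem Represents.length_mul_or (hG : A.Represents x u c G) (hH : A.Represents y u c H)
    (hGc : FreeGroup.IsCyclicallyReduced G) (hHc : FreeGroup.IsCyclicallyReduced H)
    (hx : x ≠ 1) (hy : y ≠ 1) : A.length (x * y) = A.length x + A.length y ∨
      A.length (x * y⁻¹) = A.length x + A.length y := by
  rw [hG.length_eq hGc, hH.length_eq hHc]
  refine (isCyclicallyReduced_append_or (hG.ne_nil hx) (hH.ne_nil hy) hGc hHc).imp ?_ ?_ <;>
    intro h
  · rw [(hG.mul hH).length_eq h, pathLength_append]
  · rw [(hG.mul hH.inv).length_eq h, pathLength_append, pathLength_invRev]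

theorem Represents.length_mul_le (hG : A.Represents x u c G) (hH : A.Represents y u c H)
    (hGc : FreeGroup.IsCyclicallyReduced G) (hHc : FreeGroup.IsCyclicallyReduced H) :
    A.length (x * y) ≤ A.length x + A.length y := by
  rw [hG.length_eq hGc, hH.length_eq hHc, ← pathLength_append]
  exact (hG.mul hH).length_le

/-- Disjoint axes make the product longer than the sum. With a common base point, one of the two
concatenations has no cancellation. -/
theorem le_length_mul_or (hx : x ≠ 1) (hy : y ≠ 1) :
    A.length x + A.length y ≤ A.length (x * y) ∨
      A.length x + A.length y ≤ A.length (x * y⁻¹) := by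
  rcases pair_cases (A := A) hx hy with ⟨-, h⟩ | ⟨u, c, G, H, hG, hH, hGc, hHc⟩
  · exact Or.inl h.le
  · exact (hG.length_mul_or hH hGc hHc hx hy).imp Eq.ge Eq.ge

/-- If one of the two lengths exceeds the sum, then they agree. -/
theorem length_mul_eq_of_lt (hx : x ≠ 1) (hy : y ≠ 1)
    (h : A.length x + A.length y < A.length (x * y) ∨
      A.length x + A.length y < A.length (x * y⁻¹)) :
    A.length (x * y) = A.length (x * y⁻¹) := by
  rcases pair_cases (A := A) hx hy with ⟨h', -⟩ | ⟨u, c, G, H, hG, hH, hGc, hHc⟩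
  · exact h'
  · have h1 := hG.length_mul_le hH hGc hHc
    have h2 := hG.length_mul_le hH.inv hGc (isCyclicallyReduced_invRev hHc)
    rw [length_inv] at h2
    rcases h with h | h <;> linarith

end MarkedGraph

/-! ### Recognition of roses -/

/-- Reducing `p ++ r` can destroy at most `r.length` letters at the end of the reduced word `p`. As
soon as `p` and `q` start differently, `invRev p ++ q` is reduced and has the class of `r`, so it is
no longer than `r`. -/
theorem exists_common_prefix {α : Type*} {p q r : List (α × Bool)} (hp : FreeGroup.IsReduced p)
    (hq : FreeGroup.IsReduced q) (h : FreeGroup.mk q = FreeGroup.mk (p ++ r)) :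
    ∃ s p' q', p = s ++ p' ∧ q = s ++ q' ∧ p'.length ≤ r.length := by
  classical
  induction p generalizing q with
  | nil => exact ⟨[], [], q, rfl, rfl, Nat.zero_le _⟩
  | cons x p ih =>
    by_cases hx : x ∈ q.head?
    · obtain ⟨q, rfl⟩ := List.head?_eq_some_iff.1 hx
      have h' : FreeGroup.mk q = FreeGroup.mk (p ++ r) := by
        have e : ∀ l : List (α × Bool), FreeGroup.mk (x :: l) =
          FreeGroup.mk [x] * FreeGroup.mk l := fun l => by simp
        rw [List.cons_append, e, e (p ++ r)] at h
        exact mul_left_cancel h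
      obtain ⟨s, p', q', rfl, rfl, hl⟩ := ih (hp.infix ⟨[x], [], by simp⟩)
        (hq.infix ⟨[x], [], by simp⟩) h'
      exact ⟨x :: s, p', q', rfl, rfl, hl⟩
    · refine ⟨[], x :: p, q, rfl, rfl, ?_⟩
      have h1 : FreeGroup.IsReduced (FreeGroup.invRev (x :: p) ++ q) := by
        refine isReduced_append_iff.2 ⟨isReduced_invRev hp, hq, ?_⟩
        simpa using hx
      have h2 : FreeGroup.mk (FreeGroup.invRev (x :: p) ++ q) = FreeGroup.mk r := by
        rw [← FreeGroup.mul_mk, ← FreeGroup.inv_mk, h, ← FreeGroup.mul_mk]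
        group
      have h3 := FreeGroup.reduce.sound h2
      rw [h1.reduce_eq] at h3
      have h4 := (FreeGroup.reduce.red (L := r)).length_le
      rw [← h3, List.length_append, FreeGroup.invRev_length] at h4
      omega

/-- At a junction of two images the directions are the initial letters of `σ` at two distinct
letters, so nothing cancels. -/
theorem isReduced_flatMap {α β : Type*} {σ : α × Bool → List (β × Bool)}
    (hσ : ∀ a, σ a ≠ []) (hred : ∀ a, FreeGroup.IsReduced (σ a))
    (hinv : ∀ i b, σ (i, !b) = FreeGroup.invRev (σ (i, b)))
    (hinj : Function.Injective fun a => (σ a).head?) {W : List (α × Bool)}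
    (hW : FreeGroup.IsReduced W) : FreeGroup.IsReduced (W.flatMap σ) := by
  induction W with
  | nil => simp
  | cons a W ih =>
    rw [List.flatMap_cons]
    refine isReduced_append_iff.2 ⟨hred a, ih (hW.infix ⟨[a], [], by simp⟩), ?_⟩
    cases W with
    | nil => simp
    | cons b W =>
      intro z hz hz'
      rw [List.flatMap_cons, List.head?_append_of_ne_nil _ (hσ b)] at hz'
      rw [← hinv a.1 a.2] at hz
      have h1 : (a.1, !a.2) = b := hinj (hz.trans hz'.symm)
      have h2 := (FreeGroup.isReduced_cons_cons.1 hW).1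
      rw [← h1] at h2
      simp at h2

namespace MarkedGraph

open MetricGraph

variable {n : ℕ} {A : MarkedGraph n}

theorem exists_third_edge (v : A.V) (x y : A.E × Bool) : ∃ z, A.start z = v ∧ z ≠ x ∧ z ≠ y := by
  by_contra! h
  have h1 := A.three_le_valence v
  have h2 : {z | A.start z = v} ⊆ {x, y} := fun z hz => by
    by_cases hzx : z = x
    · exact Or.inl hzx
    · exact Or.inr (h z hz hzx)
  have h3 := (Set.ncard_le_ncard h2).trans (Set.ncard_insert_le x {y})
  rw [Set.ncard_singleton] at h3
  have h4 : A.valence v = {z | A.start z = v}.ncard := rfl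
  omega

theorem exists_extension {u v : A.V} {p : List (A.E × Bool)} (hp : A.IsWalk u p v)
    (hr : FreeGroup.IsReduced p) (N : ℕ) :
    ∃ r v', A.IsWalk u (p ++ r) v' ∧ FreeGroup.IsReduced (p ++ r) ∧ r.length = N := by
  induction N with
  | zero => exact ⟨[], v, by simpa using hp, by simpa using hr, rfl⟩
  | succ N ih =>
    obtain ⟨r, v', h1, h2, h3⟩ := ih
    obtain ⟨z, hz, hz'⟩ : ∃ z, A.start z = v' ∧ z ∉ (FreeGroup.invRev (p ++ r)).head? := by
      rcases h : (FreeGroup.invRev (p ++ r)).head? with _ | x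
      · have h4 : 0 < A.valence v' := lt_of_lt_of_le (by norm_num) (A.three_le_valence v')
        obtain ⟨⟨z, hz⟩⟩ := (Nat.card_pos_iff.1 h4).1
        exact ⟨z, hz, by simp⟩
      · obtain ⟨z, hz, hzx, -⟩ := A.exists_third_edge v' x x
        exact ⟨z, hz, by simpa using Ne.symm hzx⟩
    refine ⟨r ++ [z], A.finish z, ?_, ?_, by simp [h3]⟩
    · rw [← List.append_assoc]
      exact h1.append ⟨hz, rfl⟩
    · rw [← List.append_assoc]
      refine isReduced_append_iff.2 ⟨h2, by simp, fun y hy hy' => ?_⟩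
      simp only [List.head?_cons, Option.mem_def, Option.some.injEq] at hy'
      exact hz' (hy' ▸ hy)

/-- Every reduced edge path extends to a reduced closed edge path. -/
theorem exists_closed_extension {u v : A.V} {p : List (A.E × Bool)} (hp : A.IsWalk u p v)
    (hr : FreeGroup.IsReduced p) :
    ∃ q, A.IsWalk u (p ++ q) u ∧ FreeGroup.IsReduced (p ++ q) := by
  classical
  choose r hrw using fun v => A.connected v u
  -- `D` bounds the paths that lead back to `u`. The path is prolonged by `D` further edges, so that
  -- the reduction after closing up cannot reach into `p`.
  obtain ⟨D, hD⟩ := (Set.finite_range fun v => (r v).length).bddAbove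
  obtain ⟨t, v', h1, h2, h3⟩ := exists_extension hp hr D
  have h4 := h1.append (hrw v')
  have h5 : A.IsWalk u (FreeGroup.reduce (p ++ t ++ r v')) u := h4.red FreeGroup.reduce.red
  have h6 : FreeGroup.IsReduced (FreeGroup.reduce (p ++ t ++ r v')) :=
    FreeGroup.isReduced_iff_reduce_eq.2 FreeGroup.reduce.idem
  obtain ⟨s, p', q', e1, e2, h7⟩ := exists_common_prefix h2 h6 FreeGroup.reduce.self
  have h8 : (r v').length ≤ D := hD ⟨v', rfl⟩
  obtain ⟨s', hs'⟩ : p <+: s := by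
    refine List.prefix_of_prefix_length_le ⟨t, rfl⟩ ⟨p', e1.symm⟩ ?_
    have := congrArg List.length e1
    simp only [List.length_append] at this
    omega
  rw [e2, ← hs', List.append_assoc] at h5 h6
  exact ⟨s' ++ q', h5, h6⟩

/-! ### Loops for a basis that leave a vertex in pairwise different directions. -/

section Petals

variable {u : A.V} {c : List (A.E × Bool)} {P : Fin n → List (A.E × Bool)}

/-- The edge path given by a letter, for a choice `P` of loops representing the basis. -/
def petal (P : Fin n → List (A.E × Bool)) (a : Fin n × Bool) : List (A.E × Bool) :=
  bif a.2 then P a.1 else FreeGroup.invRev (P a.1)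

theorem petal_not (i : Fin n) (b : Bool) :
    petal P (i, !b) = FreeGroup.invRev (petal P (i, b)) := by
  cases b <;> simp [petal]

theorem represents_flatMap (hP : ∀ i, A.Represents (FreeGroup.of i) u c (P i))
    (hc : A.IsWalk A.base c u) (W : List (Fin n × Bool)) :
    A.Represents (FreeGroup.mk W) u c (W.flatMap (petal P)) := by
  induction W with
  | nil =>
    refine ⟨hc, rfl, ?_⟩
    rw [List.flatMap_nil, ← FreeGroup.one_eq_mk, ← FreeGroup.one_eq_mk, map_one, mul_one,
      mul_inv_cancel]
  | cons a W ih =>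
    have e : (FreeGroup.mk (a :: W) : FreeGroup (Fin n)) = FreeGroup.mk [a] * FreeGroup.mk W := by
      simp
    rw [e, List.flatMap_cons]
    refine Represents.mul ?_ ih
    obtain ⟨i, b⟩ := a
    cases b
    · exact (hP i).inv
    · exact hP i

/-- A reduced path from `u` extends to a reduced loop. That loop is a word in the petals, which
involves no cancellation because the petals start differently. So the path and the first petal of
the word are prefixes of one another, in one order or the other. -/
theorem exists_petal_prefix (hP : ∀ i, A.Represents (FreeGroup.of i) u c (P i))
    (hc : A.IsWalk A.base c u) (hne : ∀ i, P i ≠ []) (hr : ∀ i, FreeGroup.IsReduced (P i))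
    (hinj : Function.Injective fun a => (petal P a).head?) {v : A.V} {z : A.E × Bool}
    {p : List (A.E × Bool)} (hp : A.IsWalk u (z :: p) v) (hpr : FreeGroup.IsReduced (z :: p)) :
    ∃ a r r', petal P a ++ r = z :: (p ++ r') := by
  classical
  obtain ⟨q, h1, h2⟩ := exists_closed_extension hp hpr
  have hm : FreeGroup.mk (c ++ (z :: p ++ q) ++ FreeGroup.invRev c) ∈ A.marking.range := by
    rw [A.marking_range]
    exact ⟨_, (hc.append h1).append hc.invRev, rfl⟩
  obtain ⟨w, hw⟩ := hm
  have h3 := represents_flatMap hP hc w.toWord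
  rw [FreeGroup.mk_toWord] at h3
  have h4 : FreeGroup.mk (w.toWord.flatMap (petal P)) = FreeGroup.mk (z :: p ++ q) := by
    have := h3.eq.symm.trans hw
    rw [← FreeGroup.mul_mk, ← FreeGroup.mul_mk (L₁ := c), ← FreeGroup.inv_mk] at this
    exact mul_left_cancel (mul_right_cancel this)
  have h5 : FreeGroup.IsReduced (w.toWord.flatMap (petal P)) := by
    refine isReduced_flatMap (fun a => ?_) (fun a => ?_) petal_not hinj FreeGroup.isReduced_toWord
    · obtain ⟨i, b⟩ := a
      cases b
      · exact invRev_ne_nil (hne i)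
      · exact hne i
    · obtain ⟨i, b⟩ := a
      cases b
      · exact isReduced_invRev (hr i)
      · exact hr i
  have h6 : w.toWord.flatMap (petal P) = z :: p ++ q := by
    have := FreeGroup.reduce.sound h4
    rwa [h5.reduce_eq, h2.reduce_eq] at this
  rcases hW : w.toWord with _ | ⟨a, W⟩
  · rw [hW] at h6
    simp at h6
  · rw [hW, List.flatMap_cons] at h6
    exact ⟨a, _, q, h6⟩

/-- Some petal begins with `z`. If it continued with a second edge `y`, the valence would allow a
reduced path turning elsewhere after `z`. That path also follows a petal beginning with `z`, which
must be the same one, and this is absurd. -/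
theorem exists_head_petal (hP : ∀ i, A.Represents (FreeGroup.of i) u c (P i))
    (hc : A.IsWalk A.base c u) (hne : ∀ i, P i ≠ []) (hr : ∀ i, FreeGroup.IsReduced (P i))
    (hinj : Function.Injective fun a => (petal P a).head?) {z : A.E × Bool}
    (hz : A.start z = u) : ∃ a, petal P a = [z] := by
  have hne' : ∀ a, petal P a ≠ [] := by
    rintro ⟨i, b⟩
    cases b
    · exact invRev_ne_nil (hne i)
    · exact hne i
  obtain ⟨a, r, r', h⟩ := exists_petal_prefix hP hc hne hr hinj (v := A.finish z) (p := [])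
    ⟨hz, rfl⟩ (by simp)
  refine ⟨a, ?_⟩
  obtain ⟨z', t, ht⟩ := List.exists_cons_of_ne_nil (hne' a)
  rw [ht] at h
  obtain ⟨rfl, -⟩ := List.cons.inj h
  rcases t with _ | ⟨y, t⟩
  · exact ht
  · exfalso
    obtain ⟨x, hx, hx1, hx2⟩ := A.exists_third_edge (A.finish z') y (z'.1, !z'.2)
    obtain ⟨b, s, s', h'⟩ := exists_petal_prefix hP hc hne hr hinj (v := A.finish x) (z := z')
      (p := [x]) ⟨hz, hx, rfl⟩ (by
        refine FreeGroup.isReduced_cons_cons.2 ⟨fun h1 => ?_, by simp⟩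
        by_contra h2
        refine hx2 (Prod.ext h1.symm ?_)
        revert h2
        cases z'.2 <;> cases x.2 <;> simp)
    have hba : b = a := by
      apply hinj
      obtain ⟨z'', t', ht'⟩ := List.exists_cons_of_ne_nil (hne' b)
      rw [ht'] at h'
      obtain ⟨rfl, -⟩ := List.cons.inj h'
      simp [ht, ht']
    rw [hba, ht] at h'
    simp only [List.cons_append, List.cons.injEq, true_and, List.nil_append] at h'
    exact hx1 h'.1.symm

end Petals

/-- Every edge at `u` is a whole petal and therefore returns to `u`. By connectedness `u` is the
only vertex, and the edges correspond to the two basis elements. -/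
theorem equivalent_rose {A : MarkedGraph 2} {u : A.V} {c : List (A.E × Bool)}
    {P : Fin 2 → List (A.E × Bool)}
    (hP : ∀ i, A.Represents (FreeGroup.of i) u c (P i)) (hr : ∀ i, FreeGroup.IsReduced (P i))
    (hinj : Function.Injective fun a => (petal P a).head?) {ℓ : Fin 2 → ℝ} (hℓ : ∀ i, 0 < ℓ i)
    {s : ℝ} (hs : 0 < s) (hPℓ : ∀ i, ℓ i = s * A.pathLength (P i)) :
    Equivalent A (rose ℓ hℓ) := by
  have hc := (hP 0).walk
  have hne : ∀ i, P i ≠ [] := fun i => (hP i).ne_nil (FreeGroup.of_ne_one i)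
  have key : ∀ {z : A.E × Bool}, A.start z = u → ∃ a, petal P a = [z] :=
    exists_head_petal hP hc hne hr hinj
  have hx : ∀ i, ∃ x, P i = [x] := by
    intro i
    obtain ⟨z, t, ht⟩ := List.exists_cons_of_ne_nil (hne i)
    have hz : A.start z = u := by
      have := (hP i).closed
      rw [ht] at this
      exact this.1
    obtain ⟨a, ha⟩ := key hz
    have : a = (i, true) := hinj (by change (petal P a).head? = _; rw [ha]; simp [petal, ht])
    subst this
    exact ⟨z, ha⟩
  choose x hx using hx
  have hpet : ∀ a, petal P a = [((x a.1).1, bif a.2 then (x a.1).2 else !(x a.1).2)] := by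
    rintro ⟨i, b⟩
    cases b <;> simp [petal, hx, FreeGroup.invRev]
  have hstart : ∀ a, A.IsWalk u (petal P a) u := by
    rintro ⟨i, b⟩
    cases b
    · exact (hP i).closed.invRev
    · exact (hP i).closed
  have hV : ∀ v, v = u := by
    have hwalk : ∀ (p : List (A.E × Bool)) v, A.IsWalk u p v → v = u := by
      intro p
      induction p with
      | nil => exact fun v h => h.symm
      | cons z p ih =>
        intro v h
        obtain ⟨a, ha⟩ := key h.1
        have h1 := hstart a
        rw [ha] at h1
        have h2 : A.finish z = u := h1.2
        exact ih v (h2 ▸ h.2)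
    intro v
    obtain ⟨p, hp⟩ := A.connected u v
    exact hwalk p v hp
  have hbij : Function.Bijective fun i => (x i).1 := by
    constructor
    · intro i j hij
      by_contra hne'
      have h1 : ∀ b b', petal P (i, b) ≠ petal P (j, b') := fun b b' h =>
        hne' (congrArg Prod.fst (hinj (congrArg List.head? h)))
      have hij' : (x i).1 = (x j).1 := hij
      rcases hb : (x i).2 <;> rcases hb' : (x j).2
      · exact h1 true true (by simp [hpet, hij', hb, hb'])
      · exact h1 true false (by simp [hpet, hij', hb, hb'])
      · exact h1 true false (by simp [hpet, hij', hb, hb'])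
      · exact h1 true true (by simp [hpet, hij', hb, hb'])
    · intro e
      obtain ⟨a, ha⟩ := key (z := (e, true)) (hV _)
      rw [hpet] at ha
      exact ⟨a.1, congrArg Prod.fst (List.cons.inj ha).1⟩
  let ε : Fin 2 ≃ A.E := Equiv.ofBijective _ hbij
  have hε : ∀ i, ε.symm (x i).1 = i := fun i => ε.symm_apply_apply i
  let h : Homothety A.toMetricGraph (rose ℓ hℓ).toMetricGraph :=
    { onV := ⟨fun _ => (), fun _ => u, fun v => (hV v).symm, fun _ => rfl⟩
      onE := ε.symm
      dir := fun e => (x (ε.symm e)).2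
      start_eq := fun _ => rfl
      finish_eq := fun _ => rfl
      ratio := s
      ratio_pos := hs
      len_eq := fun e => by
        obtain ⟨i, rfl⟩ := ε.surjective e
        change ℓ (ε.symm (ε i)) = _
        rw [Equiv.symm_apply_apply, hPℓ, hx]
        simp [ε] }
  have hedge : ∀ i, h.edge (x i) = (i, true) := fun i => by
    change (ε.symm (x i).1, (x i).2 == (x (ε.symm (x i).1)).2) = _
    rw [hε, beq_self_eq_true]
  refine ⟨h, c.map h.edge, h.isWalk_map hc, fun w => ?_⟩
  change (h.induced.comp A.marking) w =
    (((MulAut.conj (FreeGroup.mk (c.map h.edge))).toMonoidHom : FreeGroup (Fin 2) →* _).comp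
      (MonoidHom.id _)) w
  refine DFunLike.congr_fun (FreeGroup.ext_hom _ _ fun i => ?_) w
  simp only [MonoidHom.comp_apply]
  rw [(hP i).eq, map_mul, map_mul, map_inv, Homothety.induced_mk, Homothety.induced_mk, hx,
    List.map_singleton, hedge]
  rfl

/-- The roses `T_α` are the points of `CV_2` where the axes of `a` and `b` meet in one point. -/
theorem exists_eq_T (A : MarkedGraph 2)
    (h1 : A.length (FreeGroup.of 0 * FreeGroup.of 1) =
      A.length (FreeGroup.of 0) + A.length (FreeGroup.of 1))
    (h2 : A.length (FreeGroup.of 0 * (FreeGroup.of 1)⁻¹) =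
      A.length (FreeGroup.of 0) + A.length (FreeGroup.of 1)) :
    ∃ α, CV.of A = T α := by
  have ha := FreeGroup.of_ne_one (0 : Fin 2)
  have hb := FreeGroup.of_ne_one (1 : Fin 2)
  rcases pair_cases (A := A) ha hb with ⟨-, h⟩ | ⟨u, c, G, H, hG, hH, hGc, hHc⟩
  · exact absurd h1 h.ne'
  have la := hG.length_eq hGc
  have lb := hH.length_eq hHc
  -- Neither product cancels, so the four directions of `G` and `H` at `u` are pairwise different,
  -- which is what `equivalent_rose` needs.
  have c1 := (hG.mul hH).isCyclicallyReduced (by rw [h1, la, lb, pathLength_append])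
  have c2 := (hG.mul hH.inv).isCyclicallyReduced
    (by rw [h2, la, lb, pathLength_append, pathLength_invRev])
  have nG := hG.ne_nil ha
  have nH := hH.ne_nil hb
  have pa := pathLength_pos nG
  have pb := pathLength_pos nH
  rw [isCyclicallyReduced_append_iff nG nH hGc.1 hHc.1] at c1
  rw [isCyclicallyReduced_append_iff nG (invRev_ne_nil nH) hGc.1 (isReduced_invRev hHc.1),
    FreeGroup.invRev_invRev] at c2
  have c3 := (isCyclicallyReduced_iff_head.1 hGc).2
  have c4 := (isCyclicallyReduced_iff_head.1 hHc).2
  have hs : 0 < A.pathLength G + A.pathLength H := add_pos pa pb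
  refine ⟨⟨A.pathLength G / (A.pathLength G + A.pathLength H), div_pos pa hs,
    (div_lt_one hs).2 (by linarith)⟩, Quotient.sound ?_⟩
  refine equivalent_rose (P := ![G, H]) (u := u) (c := c) ?_ ?_ ?_ _ (inv_pos.2 hs) ?_
  · intro i
    fin_cases i
    · exact hG
    · exact hH
  · intro i
    fin_cases i
    · exact hGc.1
    · exact hHc.1
  · obtain ⟨a, G', e1⟩ := List.exists_cons_of_ne_nil nG
    obtain ⟨b, H', e2⟩ := List.exists_cons_of_ne_nil nH
    obtain ⟨a', G'', e3⟩ := List.exists_cons_of_ne_nil (invRev_ne_nil nG)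
    obtain ⟨b', H'', e4⟩ := List.exists_cons_of_ne_nil (invRev_ne_nil nH)
    have k1 : G.head? = some a := by rw [e1]; rfl
    have k2 : H.head? = some b := by rw [e2]; rfl
    have k3 : (FreeGroup.invRev G).head? = some a' := by rw [e3]; rfl
    have k4 : (FreeGroup.invRev H).head? = some b' := by rw [e4]; rfl
    rw [k1, k2, k3, k4] at c1
    rw [k1, k2, k3, k4] at c2
    rw [k1, k3] at c3
    rw [k2, k4] at c4
    simp only [Option.mem_def, Option.some.injEq, forall_eq', ne_eq] at c1 c2 c3 c4
    rintro ⟨i, s⟩ ⟨j, t⟩ hij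
    fin_cases i <;> fin_cases j <;> cases s <;> cases t <;>
      simp [petal, k1, k2, k3, k4] at hij ⊢ <;> grind
  · intro i
    fin_cases i
    · change A.pathLength G / _ = _ * A.pathLength G
      rw [div_eq_inv_mul]
    · change 1 - A.pathLength G / _ = _ * A.pathLength H
      field_simp
      ring

end MarkedGraph

open Filter Topology

/-! ### Comparison of length functions -/

namespace MetricGraph

variable {G H : MetricGraph}

theorem exists_pathLength_le (f : G.E → List (H.E × Bool)) {K : ℝ}
    (hf : ∀ e, H.pathLength (f e) ≤ K * G.len e) (p : List (G.E × Bool)) :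
    ∃ q, FreeGroup.lift (fun e => FreeGroup.mk (f e)) (FreeGroup.mk p) = FreeGroup.mk q ∧
      H.pathLength q ≤ K * G.pathLength p := by
  induction p with
  | nil => exact ⟨[], by rw [← FreeGroup.one_eq_mk, map_one, FreeGroup.one_eq_mk], by simp⟩
  | cons x p ih =>
    obtain ⟨q, h1, h2⟩ := ih
    have e1 : (FreeGroup.mk (x :: p) : FreeGroup G.E) = FreeGroup.mk [x] * FreeGroup.mk p := by simp
    obtain ⟨e, b⟩ := x
    refine ⟨(bif b then f e else FreeGroup.invRev (f e)) ++ q, ?_, ?_⟩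
    · rw [e1, map_mul, h1, ← FreeGroup.mul_mk]
      congr 1
      cases b <;> simp
    · rw [pathLength_append, pathLength_cons, mul_add]
      refine add_le_add ?_ h2
      cases b
      · simpa using hf e
      · exact hf e

end MetricGraph

namespace MarkedGraph

open MetricGraph

variable {n : ℕ} {A B : MarkedGraph n}

/-- A map `A → B` compatible with the markings that stretches every edge by at most `K` stretches
every translation length by at most `K`. -/
theorem length_le_of_lipschitz (f : A.E → List (B.E × Bool)) {K : ℝ}
    (hf : ∀ e, B.pathLength (f e) ≤ K * A.len e) (g : FreeGroup B.E)
    (h : ∀ w, B.marking w =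
      g * FreeGroup.lift (fun e => FreeGroup.mk (f e)) (A.marking w) * g⁻¹)
    (w : FreeGroup (Fin n)) : B.length w ≤ K * A.length w := by
  obtain ⟨u, c, p, hp, hpc⟩ := A.exists_represents w
  obtain ⟨u', c', p', hp', hpc'⟩ := B.exists_represents w
  rw [hp.length_eq hpc, hp'.length_eq hpc']
  obtain ⟨q, h1, h2⟩ := exists_pathLength_le f hf p
  refine (pathLength_le_of_isCyclicallyReduced hpc' ((FreeGroup.mk c')⁻¹ * g *
    FreeGroup.lift (fun e => FreeGroup.mk (f e)) (FreeGroup.mk c)) ?_).trans h2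
  have e1 : FreeGroup.mk p' = (FreeGroup.mk c')⁻¹ * B.marking w * FreeGroup.mk c' := by
    rw [hp'.eq]; group
  rw [e1, h, hp.eq, map_mul, map_mul, map_inv, ← h1]
  group

/-- Closing up each edge by chosen arcs `r` from the base point extends the inverse of the marking
to all of `FreeGroup A.E`. The arc chosen at the base point itself may be a nontrivial loop, whence
the conjugation by `y`. -/
theorem exists_marking_retraction (A : MarkedGraph n) :
    ∃ (θ : FreeGroup A.E →* FreeGroup (Fin n)) (y : FreeGroup (Fin n)),
      ∀ w, θ (A.marking w) = y * w * y⁻¹ := by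
  choose r hr using A.connected A.base
  have hmem : ∀ {p}, A.IsWalk A.base p A.base → ∃ w, A.marking w = FreeGroup.mk p := by
    intro p hp
    have : FreeGroup.mk p ∈ A.marking.range := by
      rw [A.marking_range]; exact ⟨p, hp, rfl⟩
    exact this
  have hx : ∀ e, ∃ x, A.marking x =
      FreeGroup.mk (r (A.src e) ++ [(e, true)] ++ FreeGroup.invRev (r (A.tgt e))) := fun e =>
    hmem (((hr _).append (show A.IsWalk (A.src e) [(e, true)] (A.tgt e) from ⟨rfl, rfl⟩)).append
      (hr _).invRev)
  choose x hx using hx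
  obtain ⟨y, hy⟩ := hmem (hr A.base)
  have key : ∀ (p : List (A.E × Bool)) (u v : A.V), A.IsWalk u p v →
      A.marking (FreeGroup.lift x (FreeGroup.mk p)) =
        FreeGroup.mk (r u) * FreeGroup.mk p * (FreeGroup.mk (r v))⁻¹ := by
    intro p
    induction p with
    | nil =>
      rintro u v rfl
      rw [← FreeGroup.one_eq_mk, map_one, map_one, mul_one, mul_inv_cancel]
    | cons z p ih =>
      rintro u v ⟨rfl, h⟩
      have e1 : (FreeGroup.mk (z :: p) : FreeGroup A.E) = FreeGroup.mk [z] * FreeGroup.mk p := by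
        simp
      rw [e1, map_mul, map_mul, ih _ _ h]
      obtain ⟨e, b⟩ := z
      have e3 := hx e
      rw [← FreeGroup.mul_mk, ← FreeGroup.mul_mk, ← FreeGroup.inv_mk] at e3
      cases b
      · have e2 : (FreeGroup.mk [(e, false)] : FreeGroup A.E) = (FreeGroup.mk [(e, true)])⁻¹ := rfl
        have e4 : FreeGroup.lift x (FreeGroup.mk [(e, true)]) = x e := by simp
        rw [e2, map_inv, map_inv, e4, e3]
        simp only [MetricGraph.start, MetricGraph.finish, cond_false]
        group
      · have e4 : FreeGroup.lift x (FreeGroup.mk [(e, true)]) = x e := by simp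
        rw [e4, e3]
        simp only [MetricGraph.start, MetricGraph.finish, cond_true]
        group
  refine ⟨FreeGroup.lift x, y, fun w => A.marking_injective ?_⟩
  have hm : A.marking w ∈ A.fundamentalGroup A.base := A.marking_range ▸ ⟨w, rfl⟩
  obtain ⟨p, hp, e⟩ := hm
  rw [← e, key p _ _ hp, e, ← hy, map_mul, map_mul, map_inv]

/-- The markings are joined by a map sending each edge to an edge path, and a finite graph has a
largest stretch. -/
theorem exists_length_le (A B : MarkedGraph n) : ∃ K, ∀ w, B.length w ≤ K * A.length w := by
  obtain ⟨θ, y, hθ⟩ := A.exists_marking_retraction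
  choose f hf using fun e => Quot.exists_rep (B.marking (θ (FreeGroup.of e)))
  obtain ⟨K, hK⟩ := (Set.finite_range fun e => B.pathLength (f e) / A.len e).bddAbove
  refine ⟨K, length_le_of_lipschitz f (fun e => ?_) (B.marking y)⁻¹ fun w => ?_⟩
  · exact (div_le_iff₀ (A.len_pos e)).1 (hK ⟨e, rfl⟩)
  · have e1 : FreeGroup.lift (fun e => FreeGroup.mk (f e)) = B.marking.comp θ := by
      ext e
      rw [FreeGroup.lift_apply_of]
      exact hf e
    rw [e1, MonoidHom.comp_apply, hθ, map_mul, map_mul, map_inv]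
    group

theorem volume_pos (A : MarkedGraph n) : 0 < A.volume := by
  have : Nonempty A.E := by
    have h4 : 0 < A.valence A.base := lt_of_lt_of_le (by norm_num) (A.three_le_valence _)
    obtain ⟨⟨z, hz⟩⟩ := (Nat.card_pos_iff.1 h4).1
    exact ⟨z.1⟩
  exact Finset.sum_pos (fun e _ => A.len_pos e) Finset.univ_nonempty

end MarkedGraph

/-! ### Normalised length functions and stretch factors. -/

namespace CV

variable {n : ℕ} (Z W : CV n) {x y w : FreeGroup (Fin n)}

theorem unitLength_of (A : MarkedGraph n) (w : FreeGroup (Fin n)) :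
    (of A).unitLength w = A.length w / A.volume := rfl

theorem unitLength_pos (hw : w ≠ 1) : 0 < Z.unitLength w := by
  obtain ⟨A, rfl⟩ := Quotient.exists_rep Z
  exact div_pos (A.length_pos hw) A.volume_pos

theorem le_unitLength_mul_or (hx : x ≠ 1) (hy : y ≠ 1) :
    Z.unitLength x + Z.unitLength y ≤ Z.unitLength (x * y) ∨
      Z.unitLength x + Z.unitLength y ≤ Z.unitLength (x * y⁻¹) := by
  obtain ⟨A, rfl⟩ := Quotient.exists_rep Z
  change A.length x / A.volume + A.length y / A.volume ≤ A.length (x * y) / A.volume ∨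
    A.length x / A.volume + A.length y / A.volume ≤ A.length (x * y⁻¹) / A.volume
  rw [← add_div, div_le_div_iff_of_pos_right A.volume_pos,
    div_le_div_iff_of_pos_right A.volume_pos]
  exact MarkedGraph.le_length_mul_or hx hy

theorem unitLength_mul_eq_of_lt (hx : x ≠ 1) (hy : y ≠ 1)
    (h : Z.unitLength x + Z.unitLength y < Z.unitLength (x * y) ∨
      Z.unitLength x + Z.unitLength y < Z.unitLength (x * y⁻¹)) :
    Z.unitLength (x * y) = Z.unitLength (x * y⁻¹) := by
  obtain ⟨A, rfl⟩ := Quotient.exists_rep Z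
  change A.length x / A.volume + A.length y / A.volume < A.length (x * y) / A.volume ∨
    A.length x / A.volume + A.length y / A.volume < A.length (x * y⁻¹) / A.volume at h
  rw [← add_div, div_lt_div_iff_of_pos_right A.volume_pos,
    div_lt_div_iff_of_pos_right A.volume_pos] at h
  change A.length (x * y) / A.volume = A.length (x * y⁻¹) / A.volume
  rw [MarkedGraph.length_mul_eq_of_lt hx hy h]

theorem exists_eq_T (Z : CV 2)
    (h1 : Z.unitLength (FreeGroup.of 0 * FreeGroup.of 1) =
      Z.unitLength (FreeGroup.of 0) + Z.unitLength (FreeGroup.of 1))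
    (h2 : Z.unitLength (FreeGroup.of 0 * (FreeGroup.of 1)⁻¹) =
      Z.unitLength (FreeGroup.of 0) + Z.unitLength (FreeGroup.of 1)) :
    Z ∈ Set.range T := by
  obtain ⟨A, rfl⟩ := Quotient.exists_rep Z
  change A.length _ / A.volume = A.length _ / A.volume + A.length _ / A.volume at h1 h2
  rw [← add_div, div_left_inj' A.volume_pos.ne'] at h1 h2
  obtain ⟨α, h⟩ := A.exists_eq_T h1 h2
  exact ⟨α, h.symm⟩

/-- An unbounded real supremum would have the default value 0. Finiteness is what lets a single word
bound a stretch factor from below. -/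
theorem bddAbove_ratio : BddAbove (Set.range fun w : {w : FreeGroup (Fin n) // w ≠ 1} =>
    W.unitLength w / Z.unitLength w) := by
  obtain ⟨A, rfl⟩ := Quotient.exists_rep Z
  obtain ⟨B, rfl⟩ := Quotient.exists_rep W
  obtain ⟨K, hK⟩ := A.exists_length_le B
  refine ⟨K * A.volume / B.volume, ?_⟩
  rintro _ ⟨⟨w, hw⟩, rfl⟩
  change B.length w / B.volume / (A.length w / A.volume) ≤ _
  have h1 := A.length_pos hw
  have h2 := A.volume_pos
  have h3 := B.volume_pos
  rw [div_div_div_eq, div_le_div_iff₀ (by positivity) h3]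
  have := mul_le_mul_of_nonneg_right (hK w) (mul_pos h2 h3).le
  linarith

theorem ratio_le_stretchR (hw : w ≠ 1) : W.unitLength w / Z.unitLength w ≤ stretchR Z W :=
  le_ciSup (bddAbove_ratio Z W) ⟨w, hw⟩

theorem ratio_le_stretchL (hw : w ≠ 1) : Z.unitLength w / W.unitLength w ≤ stretchL Z W :=
  ratio_le_stretchR W Z hw

theorem stretchR_pos [NeZero n] : 0 < stretchR Z W := by
  have h : FreeGroup.of (0 : Fin n) ≠ 1 := FreeGroup.of_ne_one _
  exact (div_pos (unitLength_pos W h) (unitLength_pos Z h)).trans_le (ratio_le_stretchR Z W h)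

theorem stretchL_pos [NeZero n] : 0 < stretchL Z W := stretchR_pos W Z

theorem stretchR_le {A B : MarkedGraph n} (hv : A.volume = B.volume) {K : ℝ} (hK : 0 ≤ K)
    (h : ∀ w, B.length w ≤ K * A.length w) : stretchR (of A) (of B) ≤ K := by
  refine Real.iSup_le (fun ⟨w, hw⟩ => ?_) hK
  rw [div_le_iff₀ (unitLength_pos _ hw), unitLength_of, unitLength_of, hv, mul_div_assoc']
  exact div_le_div_of_nonneg_right (h w) B.volume_pos.le

/-! ### The topology of `CV_n` -/

/-- A scale-invariant open set is saturated for the projectivisation, so it descends to an open set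
there. All conditions used below are homogeneous in the lengths. -/
theorem isOpen_setOf_unitLength_mem {U : Set (FreeGroup (Fin n) → ℝ)} (hU : IsOpen U)
    (hinv : ∀ c : ℝ, 0 < c → ∀ f ∈ U, (fun w => c * f w) ∈ U) :
    IsOpen {Z : CV n | Z.unitLength ∈ U} := by
  refine isOpen_induced_iff.2 ⟨Quotient.mk (homothetySetoid n) '' U, ?_, ?_⟩
  · refine isOpen_coinduced.2 ?_
    convert hU using 1
    ext f
    constructor
    · rintro ⟨g, hg, h⟩
      obtain ⟨c, hc, h⟩ := Quotient.exact h
      rw [show f = fun w => c * g w from funext h]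
      exact hinv c hc g hg
    · exact fun hf => ⟨f, hf, rfl⟩
  · ext Z
    constructor
    · rintro ⟨g, hg, h⟩
      obtain ⟨c, hc, h⟩ := Quotient.exact h
      change Z.unitLength ∈ U
      rw [show Z.unitLength = fun w => c * g w from funext h]
      exact hinv c hc g hg
    · exact fun hf => ⟨Z.unitLength, hf, rfl⟩

theorem isOpen_lt (x y : FreeGroup (Fin n)) : IsOpen {Z : CV n | Z.unitLength x < Z.unitLength y} :=
  isOpen_setOf_unitLength_mem (U := {f | f x < f y})
    (_root_.isOpen_lt (continuous_apply x) (continuous_apply y))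
    fun _ hc _ hf => mul_lt_mul_of_pos_left hf hc

theorem isOpen_add_lt (x y z : FreeGroup (Fin n)) :
    IsOpen {Z : CV n | Z.unitLength x + Z.unitLength y < Z.unitLength z} :=
  isOpen_setOf_unitLength_mem (U := {f | f x + f y < f z})
    (_root_.isOpen_lt ((continuous_apply x).add (continuous_apply y)) (continuous_apply z))
    fun c hc f hf => by
      have := mul_lt_mul_of_pos_left hf hc
      simpa [mul_add] using this

theorem isOpen_lt_add (x y z : FreeGroup (Fin n)) :
    IsOpen {Z : CV n | Z.unitLength z < Z.unitLength x + Z.unitLength y} :=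
  isOpen_setOf_unitLength_mem (U := {f | f z < f x + f y})
    (_root_.isOpen_lt (continuous_apply z) ((continuous_apply x).add (continuous_apply y)))
    fun c hc f hf => by
      have := mul_lt_mul_of_pos_left hf hc
      simpa [mul_add] using this

theorem isClosed_eq_add (x y z : FreeGroup (Fin n)) :
    IsClosed {Z : CV n | Z.unitLength z = Z.unitLength x + Z.unitLength y} := by
  rw [← isOpen_compl_iff]
  convert (isOpen_add_lt x y z).union (isOpen_lt_add x y z) using 1
  ext Z
  simp only [Set.mem_compl_iff, Set.mem_ofPred_eq, Set.mem_union]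
  rw [← ne_eq, ne_comm, lt_or_lt_iff_ne, ne_comm, ne_comm]

/-- The map from functions to their projective classes is continuous. -/
theorem tendsto_of_unitLength {ι : Type*} {l : Filter ι} {F : ι → CV n} {Z : CV n}
    (h : ∀ w, Tendsto (fun i => (F i).unitLength w) l (𝓝 (Z.unitLength w))) :
    Tendsto F l (𝓝 Z) := by
  rw [nhds_induced, tendsto_comap_iff]
  exact (continuous_quotient_mk'.tendsto Z.unitLength).comp (tendsto_pi_nhds.2 h)

end CV

/-! ### Geodesics -/

/-- Only the subdivision `0, t, 1` is used; no triangle inequality enters. -/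
theorem IsGeodesic.add_le {M : Type*} [TopologicalSpace M] {D : M → M → ℝ} {x y : M}
    {γ : Path x y} (h : IsGeodesic D γ) (t : unitInterval) :
    D x (γ t) + D (γ t) y ≤ D x y := by
  refine h.1 ⟨2, fun i => if i = 0 then 0 else if i = 1 then t else 1, ?_, rfl, rfl, ?_⟩
  · refine monotone_nat_of_le_succ fun i => ?_
    rcases i with _ | _ | i
    · exact t.2.1
    · exact t.2.2
    · simp
  · simp [Finset.sum_range_succ]

theorem exists_mem_of_isOpen {M : Type*} [TopologicalSpace M] {x y : M} (γ : Path x y)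
    {U V : Set M} (hU : IsOpen U) (hV : IsOpen V) (hUV : Disjoint U V) (hx : x ∈ U) (hy : y ∈ V) :
    ∃ t, γ t ∉ U ∧ γ t ∉ V := by
  by_contra! h
  have h1 := isPreconnected_univ (γ ⁻¹' U) (γ ⁻¹' V) (hU.preimage γ.continuous)
    (hV.preimage γ.continuous) (fun t _ => by
      by_cases ht : γ t ∈ U
      · exact Or.inl ht
      · exact Or.inr (h t ht)) ⟨0, trivial, by simpa using hx⟩ ⟨1, trivial, by simpa using hy⟩
  obtain ⟨t, -, h2, h3⟩ := h1
  exact Set.disjoint_left.1 hUV h2 h3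


/-! ### Theta-graphs and roses -/

namespace MarkedGraph

open MetricGraph

variable {n : ℕ} {A : MarkedGraph n}

theorem represents_base {w : FreeGroup (Fin n)} {p : List (A.E × Bool)}
    (hp : A.IsWalk A.base p A.base) (h : A.marking w = FreeGroup.mk p) :
    A.Represents w A.base [] p :=
  ⟨rfl, hp, by rw [← FreeGroup.one_eq_mk, one_mul, inv_one, mul_one, h]⟩

theorem length_one : A.length 1 = 0 :=
  (represents_base (w := 1) (p := []) rfl (map_one _)).length_eq .nil

/-- Translation lengths in a theta-graph embedded in `A`. -/
theorem length_of_theta {x y : FreeGroup (Fin n)} {e₀ e₁ e₂ : A.E} (h01 : e₀ ≠ e₁) (h02 : e₀ ≠ e₂)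
    (h12 : e₁ ≠ e₂) (hs : ∀ e, A.src e = A.base) {v : A.V} (ht : ∀ e, A.tgt e = v)
    (hx : A.marking x = FreeGroup.of e₀ * (FreeGroup.of e₁)⁻¹)
    (hy : A.marking y = FreeGroup.of e₂ * (FreeGroup.of e₁)⁻¹) :
    A.length x = A.len e₀ + A.len e₁ ∧ A.length y = A.len e₂ + A.len e₁ ∧
      A.length (x * y) = A.len e₀ + 2 * A.len e₁ + A.len e₂ ∧
      A.length (x * y⁻¹) = A.len e₀ + A.len e₂ := by
  have hw : ∀ e e' : A.E, A.IsWalk A.base [(e, true), (e', false)] A.base := fun e e' =>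
    ⟨hs e, (ht e').trans (ht e).symm, hs e'⟩
  have hm : ∀ e e' : A.E, FreeGroup.of e * (FreeGroup.of e')⁻¹ =
    FreeGroup.mk [(e, true), (e', false)] := fun _ _ => rfl
  have rx := represents_base (hw e₀ e₁) (hx.trans (hm _ _))
  have ry := represents_base (hw e₂ e₁) (hy.trans (hm _ _))
  have rxy' : A.Represents (x * y⁻¹) A.base [] [(e₀, true), (e₂, false)] :=
    represents_base (hw e₀ e₂) (by rw [← hm, map_mul, map_inv, hx, hy]; group)
  refine ⟨?_, ?_, ?_, ?_⟩
  · rw [rx.length_eq ⟨by simp [FreeGroup.IsReduced, h01], by simp [h01.symm]⟩]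
    simp
  · rw [ry.length_eq ⟨by simp [FreeGroup.IsReduced, h12.symm], by simp [h12]⟩]
    simp
  · rw [(rx.mul ry).length_eq ⟨by simp [FreeGroup.IsReduced, h01, h12, h12.symm],
      by simp [h01.symm]⟩]
    simp
    ring
  · rw [rxy'.length_eq ⟨by simp [FreeGroup.IsReduced, h02], by simp [h02.symm]⟩]
    simp

theorem length_le_of_lipschitz_of {B : MarkedGraph n} (f : A.E → List (B.E × Bool)) {K : ℝ}
    (hf : ∀ e, B.pathLength (f e) ≤ K * A.len e) (g : FreeGroup B.E)
    (h : ∀ i, B.marking (FreeGroup.of i) =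
      g * FreeGroup.lift (fun e => FreeGroup.mk (f e)) (A.marking (FreeGroup.of i)) * g⁻¹)
    (w : FreeGroup (Fin n)) : B.length w ≤ K * A.length w := by
  refine length_le_of_lipschitz f hf g (fun w => ?_) w
  have e : B.marking = (MulAut.conj g).toMonoidHom.comp
      ((FreeGroup.lift fun e => FreeGroup.mk (f e)).comp A.marking) :=
    FreeGroup.ext_hom _ _ h
  exact DFunLike.congr_fun e w

end MarkedGraph

theorem markX_of_zero : markX (FreeGroup.of 0) = FreeGroup.of 0 * (FreeGroup.of 1)⁻¹ := by
  simp [markX]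

theorem markX_of_one : markX (FreeGroup.of 1) = FreeGroup.of 2 * (FreeGroup.of 1)⁻¹ := by
  simp [markX]

theorem markY_of_zero : markY (FreeGroup.of 0) = FreeGroup.of 0 * (FreeGroup.of 1)⁻¹ := by
  simp [markY]

theorem markY_of_one : markY (FreeGroup.of 1) = FreeGroup.of 1 * (FreeGroup.of 2)⁻¹ := by
  simp [markY]

theorem CV.unitLength_one {n : ℕ} (Z : CV n) : Z.unitLength 1 = 0 := by
  obtain ⟨A, rfl⟩ := Quotient.exists_rep Z
  change A.length 1 / A.volume = 0
  rw [MarkedGraph.length_one, zero_div]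

theorem fin_three_ne : (0 : Fin 3) ≠ 1 ∧ (0 : Fin 3) ≠ 2 ∧ (1 : Fin 3) ≠ 2 := by decide

theorem thetaX_length (ℓ : Fin 3 → ℝ) (hℓ : ∀ i, 0 < ℓ i) :
    (thetaX ℓ hℓ).length (FreeGroup.of 0) = ℓ 0 + ℓ 1 ∧
      (thetaX ℓ hℓ).length (FreeGroup.of 1) = ℓ 2 + ℓ 1 ∧
      (thetaX ℓ hℓ).length (FreeGroup.of 0 * FreeGroup.of 1) = ℓ 0 + 2 * ℓ 1 + ℓ 2 ∧
      (thetaX ℓ hℓ).length (FreeGroup.of 0 * (FreeGroup.of 1)⁻¹) = ℓ 0 + ℓ 2 :=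
  MarkedGraph.length_of_theta (A := thetaX ℓ hℓ) (e₀ := (0 : Fin 3)) (e₁ := (1 : Fin 3))
    (e₂ := (2 : Fin 3)) fin_three_ne.1 fin_three_ne.2.1 fin_three_ne.2.2 (fun _ => rfl) (v := true)
    (fun _ => rfl) markX_of_zero markX_of_one

theorem thetaY_length (ℓ : Fin 3 → ℝ) (hℓ : ∀ i, 0 < ℓ i) :
    (thetaY ℓ hℓ).length (FreeGroup.of 0) = ℓ 0 + ℓ 1 ∧
      (thetaY ℓ hℓ).length (FreeGroup.of 1) = ℓ 2 + ℓ 1 ∧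
      (thetaY ℓ hℓ).length (FreeGroup.of 0 * (FreeGroup.of 1)⁻¹) = ℓ 0 + 2 * ℓ 1 + ℓ 2 ∧
      (thetaY ℓ hℓ).length (FreeGroup.of 0 * FreeGroup.of 1) = ℓ 0 + ℓ 2 := by
  -- The marking sends `b⁻¹` to `G F⁻¹`, so this graph has the pattern of `thetaX` with `b⁻¹` in
  -- place of `b`.
  have h := MarkedGraph.length_of_theta (A := thetaY ℓ hℓ) (x := FreeGroup.of 0)
    (y := (FreeGroup.of 1)⁻¹) (e₀ := (0 : Fin 3)) (e₁ := (1 : Fin 3))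
    (e₂ := (2 : Fin 3)) fin_three_ne.1 fin_three_ne.2.1 fin_three_ne.2.2 (fun _ => rfl) (v := true)
    (fun _ => rfl) markY_of_zero
    ((map_inv markY _).trans (by rw [markY_of_one, mul_inv_rev, inv_inv]; rfl))
  rwa [MarkedGraph.length_inv, inv_inv] at h

theorem thetaX_volume (ℓ : Fin 3 → ℝ) (hℓ : ∀ i, 0 < ℓ i) :
    (thetaX ℓ hℓ).volume = ℓ 0 + ℓ 1 + ℓ 2 := Fin.sum_univ_three ℓ

theorem thetaY_volume (ℓ : Fin 3 → ℝ) (hℓ : ∀ i, 0 < ℓ i) :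
    (thetaY ℓ hℓ).volume = ℓ 0 + ℓ 1 + ℓ 2 := Fin.sum_univ_three ℓ

theorem rose_volume (ℓ : Fin 2 → ℝ) (hℓ : ∀ i, 0 < ℓ i) : (rose ℓ hℓ).volume = ℓ 0 + ℓ 1 :=
  Fin.sum_univ_two ℓ

theorem rose_length (ℓ : Fin 2 → ℝ) (hℓ : ∀ i, 0 < ℓ i) :
    (rose ℓ hℓ).length (FreeGroup.of 0) = ℓ 0 ∧
      (rose ℓ hℓ).length (FreeGroup.of 1) = ℓ 1 ∧
      (rose ℓ hℓ).length (FreeGroup.of 0 * FreeGroup.of 1) = ℓ 0 + ℓ 1 ∧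
      (rose ℓ hℓ).length (FreeGroup.of 0 * (FreeGroup.of 1)⁻¹) = ℓ 0 + ℓ 1 := by
  have h : ∀ i : Fin 2, (rose ℓ hℓ).Represents (FreeGroup.of i) () [] [(i, true)] := fun i =>
    MarkedGraph.represents_base (A := rose ℓ hℓ) ⟨rfl, rfl⟩ rfl
  have hlen : ∀ i : Fin 2, (rose ℓ hℓ).len i = ℓ i := fun _ => rfl
  refine ⟨?_, ?_, ?_, ?_⟩
  · rw [(h 0).length_eq .singleton]
    exact add_zero _
  · rw [(h 1).length_eq .singleton]
    exact add_zero _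
  · have hc : FreeGroup.IsCyclicallyReduced [((0 : Fin 2), true), ((1 : Fin 2), true)] :=
      ⟨by simp [FreeGroup.IsReduced], by simp⟩
    rw [((h 0).mul (h 1)).length_eq hc]
    simp [hlen]
  · have hc : FreeGroup.IsCyclicallyReduced [((0 : Fin 2), true), ((1 : Fin 2), false)] :=
      ⟨by simp [FreeGroup.IsReduced], by simp⟩
    rw [((h 0).mul (h 1).inv).length_eq hc]
    simp [hlen]

theorem T_unitLength (α : Set.Ioo (0 : ℝ) 1) :
    (T α).unitLength (FreeGroup.of 0) = α ∧ (T α).unitLength (FreeGroup.of 1) = 1 - α ∧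
      (T α).unitLength (FreeGroup.of 0 * FreeGroup.of 1) = 1 ∧
      (T α).unitLength (FreeGroup.of 0 * (FreeGroup.of 1)⁻¹) = 1 := by
  simp only [T, CV.unitLength_of, rose_volume, rose_length]
  simp

theorem T_pos (α : Set.Ioo (0 : ℝ) 1) : ∀ i, 0 < (![(α : ℝ), 1 - α] : Fin 2 → ℝ) i :=
  Fin.forall_fin_two.2 ⟨α.2.1, sub_pos.2 α.2.2⟩

theorem T_unitLength_eq (α : Set.Ioo (0 : ℝ) 1)
    (w : FreeGroup (Fin 2)) : (T α).unitLength w = (rose ![(α : ℝ), 1 - α] (T_pos α)).length w := by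
  simp only [T, CV.unitLength_of, rose_volume]
  simp

/-! ### Lengths and stretch factors of `X` and `Y`. -/

theorem X_unitLength :
    X.unitLength (FreeGroup.of 0) = 1 / 2 ∧ X.unitLength (FreeGroup.of 1) = 5 / 6 ∧
      X.unitLength (FreeGroup.of 0 * FreeGroup.of 1) = 4 / 3 ∧
      X.unitLength (FreeGroup.of 0 * (FreeGroup.of 1)⁻¹) = 2 / 3 := by
  simp only [X, CV.unitLength_of, thetaX_volume, thetaX_length, Matrix.cons_val]
  norm_num

theorem Y_unitLength :
    Y.unitLength (FreeGroup.of 0) = 5 / 6 ∧ Y.unitLength (FreeGroup.of 1) = 1 / 2 ∧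
      Y.unitLength (FreeGroup.of 0 * FreeGroup.of 1) = 2 / 3 ∧
      Y.unitLength (FreeGroup.of 0 * (FreeGroup.of 1)⁻¹) = 4 / 3 := by
  simp only [Y, CV.unitLength_of, thetaY_volume, thetaY_length, Matrix.cons_val]
  norm_num

/-- The map is `A ↦ F⁻¹`, `B ↦ E⁻¹`, `C ↦ E⁻¹ F G⁻¹`, compatible with the markings up to conjugation
by `E`. It stretches the edges by 2, 3/2 and 2. -/
theorem stretchR_X_Y_le : CV.stretchR X Y ≤ 2 := by
  refine CV.stretchR_le (by simp only [thetaX_volume, thetaY_volume, Matrix.cons_val]; norm_num)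
    (by norm_num) ?_
  let f : Fin 3 → List (Fin 3 × Bool) := ![[((1 : Fin 3), false)], [((0 : Fin 3), false)],
    [((0 : Fin 3), false), ((1 : Fin 3), true), ((2 : Fin 3), false)]]
  let φ : FreeGroup (Fin 3) →* FreeGroup (Fin 3) := FreeGroup.lift fun e => FreeGroup.mk (f e)
  have h0 : φ (FreeGroup.of 0) = (FreeGroup.of 1)⁻¹ := FreeGroup.lift_apply_of
  have h1 : φ (FreeGroup.of 1) = (FreeGroup.of 0)⁻¹ := FreeGroup.lift_apply_of
  have h2 : φ (FreeGroup.of 2) = (FreeGroup.of 0)⁻¹ * FreeGroup.of 1 * (FreeGroup.of 2)⁻¹ :=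
    FreeGroup.lift_apply_of
  have hφ : ∀ i : Fin 2, markY (FreeGroup.of i) =
      FreeGroup.of 0 * φ (markX (FreeGroup.of i)) * (FreeGroup.of 0)⁻¹ := by
    refine Fin.forall_fin_two.2 ⟨?_, ?_⟩
    · rw [markX_of_zero, markY_of_zero, map_mul, map_inv, h0, h1]
      group
    · rw [markX_of_one, markY_of_one, map_mul, map_inv, h1, h2]
      group
  refine MarkedGraph.length_le_of_lipschitz_of f ?_ (FreeGroup.of (0 : Fin 3)) fun i => ?_
  · change ∀ e : Fin 3, _
    intro e
    fin_cases e <;> simp [f, MetricGraph.pathLength, thetaX, thetaY, thetaGraph] <;> norm_num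
  · exact hφ i

/-- The map is `E ↦ A B⁻¹ C`, `F ↦ C`, `G ↦ B`, stretching the edges by 2, 3/2 and 2. -/
theorem stretchL_X_Y_le : CV.stretchL X Y ≤ 2 := by
  -- By definition `stretchL X Y` unfolds to `stretchR Y X`.
  refine CV.stretchR_le (by simp only [thetaX_volume, thetaY_volume, Matrix.cons_val]; norm_num)
    (by norm_num) ?_
  let f : Fin 3 → List (Fin 3 × Bool) := ![[((0 : Fin 3), true), ((1 : Fin 3), false),
    ((2 : Fin 3), true)], [((2 : Fin 3), true)], [((1 : Fin 3), true)]]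
  let φ : FreeGroup (Fin 3) →* FreeGroup (Fin 3) := FreeGroup.lift fun e => FreeGroup.mk (f e)
  have h0 : φ (FreeGroup.of 0) = FreeGroup.of 0 * (FreeGroup.of 1)⁻¹ * FreeGroup.of 2 :=
    FreeGroup.lift_apply_of
  have h1 : φ (FreeGroup.of 1) = FreeGroup.of 2 := FreeGroup.lift_apply_of
  have h2 : φ (FreeGroup.of 2) = FreeGroup.of 1 := FreeGroup.lift_apply_of
  have hφ : ∀ i : Fin 2, markX (FreeGroup.of i) = 1 * φ (markY (FreeGroup.of i)) * 1⁻¹ := by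
    refine Fin.forall_fin_two.2 ⟨?_, ?_⟩
    · rw [markX_of_zero, markY_of_zero, map_mul, map_inv, h0, h1]
      group
    · rw [markX_of_one, markY_of_one, map_mul, map_inv, h1, h2]
      group
  refine MarkedGraph.length_le_of_lipschitz_of f ?_ 1 fun i => ?_
  · change ∀ e : Fin 3, _
    intro e
    fin_cases e <;> simp [f, MetricGraph.pathLength, thetaX, thetaY, thetaGraph] <;> norm_num
  · exact hφ i

/-! ### The common edge -/

/-- In this simplex the loops for `a` and `b` share the middle edge with the same orientation, so
`ab` has no cancellation. The relation is a closed condition. -/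
theorem closure_simplexX_subset : closure simplexX ⊆
    {Z | Z.unitLength (FreeGroup.of 0 * FreeGroup.of 1) =
      Z.unitLength (FreeGroup.of 0) + Z.unitLength (FreeGroup.of 1)} := by
  refine closure_minimal ?_ (CV.isClosed_eq_add _ _ _)
  rintro _ ⟨ℓ, hℓ, rfl⟩
  simp only [Set.mem_ofPred_eq, CV.unitLength_of, thetaX_length]
  ring

theorem closure_simplexY_subset : closure simplexY ⊆
    {Z | Z.unitLength (FreeGroup.of 0 * (FreeGroup.of 1)⁻¹) =
      Z.unitLength (FreeGroup.of 0) + Z.unitLength (FreeGroup.of 1)} := by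
  refine closure_minimal ?_ (CV.isClosed_eq_add _ _ _)
  rintro _ ⟨ℓ, hℓ, rfl⟩
  simp only [Set.mem_ofPred_eq, CV.unitLength_of, thetaY_length]
  ring

theorem inv_nat_pos (k : ℕ) : 0 < 1 / ((k : ℝ) + 1) := by positivity

/-- The lengths of the theta-graphs that degenerate to the rose `T_α`. -/
theorem nearT_pos (α : Set.Ioo (0 : ℝ) 1) (k : ℕ) :
    ∀ i, 0 < (![(α : ℝ), 1 / ((k : ℝ) + 1), 1 - α] : Fin 3 → ℝ) i := by
  intro i
  have h1 := α.2.1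
  have h2 := α.2.2
  have h3 := inv_nat_pos k
  fin_cases i
  · exact h1
  · exact h3
  · simpa using h2

/-- The two bounds, divided by volumes tending to 1, squeeze every normalised length. -/
theorem tendsto_T_of_bounds {α : Set.Ioo (0 : ℝ) 1} {F : ℕ → MarkedGraph 2}
    (hv : ∀ k : ℕ, (F k).volume = 1 + 1 / ((k : ℝ) + 1)) {C : ℝ}
    (h1 : ∀ k w, (T α).unitLength w ≤ (F k).length w)
    (h2 : ∀ k w, (F k).length w ≤ (1 + C * (1 / ((k : ℝ) + 1))) * (T α).unitLength w) :
    Tendsto (fun k => CV.of (F k)) atTop (𝓝 (T α)) := by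
  refine CV.tendsto_of_unitLength fun w => ?_
  have h0 := tendsto_one_div_add_atTop_nhds_zero_nat (𝕜 := ℝ)
  have hv' : Tendsto (fun k : ℕ => 1 + 1 / ((k : ℝ) + 1)) atTop (𝓝 1) := by
    simpa using h0.const_add 1
  have hl : Tendsto (fun k : ℕ => (T α).unitLength w / (1 + 1 / ((k : ℝ) + 1))) atTop
      (𝓝 ((T α).unitLength w)) := by
    have := (tendsto_const_nhds (x := (T α).unitLength w)).div hv' one_ne_zero
    rwa [div_one] at this
  have hu : Tendsto (fun k : ℕ => (1 + C * (1 / ((k : ℝ) + 1))) * (T α).unitLength w /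
      (1 + 1 / ((k : ℝ) + 1))) atTop (𝓝 ((T α).unitLength w)) := by
    have := (((h0.const_mul C).const_add 1).mul_const ((T α).unitLength w)).div hv' one_ne_zero
    rwa [mul_zero, add_zero, one_mul, div_one] at this
  refine tendsto_of_tendsto_of_tendsto_of_le_of_le hl hu (fun k => ?_) fun k => ?_
  · change _ ≤ (F k).length w / (F k).volume
    rw [hv]
    exact div_le_div_of_nonneg_right (h1 k w) (by have := inv_nat_pos k; linarith)
  · change (F k).length w / (F k).volume ≤ _
    rw [hv]
    exact div_le_div_of_nonneg_right (h2 k w) (by have := inv_nat_pos k; linarith)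

/-- Petals of lengths `α` and `β` are to be lengthened by `ε`. The relative increases are `ε / α`
and `ε / β`, and their sum dominates both. -/
theorem add_le_stretch {α β ε : ℝ} (hα : 0 < α) (hβ : 0 < β) (hε : 0 < ε) :
    α + ε ≤ (1 + (1 / α + 1 / β) * ε) * α ∧ β + ε ≤ (1 + (1 / α + 1 / β) * ε) * β := by
  have h1 : (1 + (1 / α + 1 / β) * ε) * α = α + ε + α / β * ε := by field_simp; ring
  have h2 : (1 + (1 / α + 1 / β) * ε) * β = β + ε + β / α * ε := by field_simp; ring
  rw [h1, h2]
  exact ⟨le_add_of_nonneg_right (by positivity), le_add_of_nonneg_right (by positivity)⟩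

/-- The middle edge shrinks to length `1 / (k + 1)`. Collapsing it is 1-Lipschitz, and the map back
sends each petal to a path longer by that amount. -/
theorem T_mem_closure_simplexX (α : Set.Ioo (0 : ℝ) 1) : T α ∈ closure simplexX := by
  have hα : 0 < (α : ℝ) := α.2.1
  have hα' : 0 < 1 - (α : ℝ) := sub_pos.2 α.2.2
  refine mem_closure_of_tendsto (b := atTop) (tendsto_T_of_bounds
    (F := fun k => thetaX _ (nearT_pos α k)) (C := 1 / α + 1 / (1 - α)) (fun k => ?_) ?_ ?_)
    (Eventually.of_forall fun k => ⟨_, _, rfl⟩)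
  · simp only [thetaX_volume, Matrix.cons_val]
    ring
  · intro k w
    rw [T_unitLength_eq, ← one_mul ((thetaX _ _).length w)]
    let f : Fin 3 → List (Fin 2 × Bool) := ![[((0 : Fin 2), true)], [], [((1 : Fin 2), true)]]
    let φ : FreeGroup (Fin 3) →* FreeGroup (Fin 2) := FreeGroup.lift fun e => FreeGroup.mk (f e)
    have h0 : φ (FreeGroup.of 0) = FreeGroup.of 0 := FreeGroup.lift_apply_of
    have h1 : φ (FreeGroup.of 1) = 1 := FreeGroup.lift_apply_of
    have h2 : φ (FreeGroup.of 2) = FreeGroup.of 1 := FreeGroup.lift_apply_of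
    refine MarkedGraph.length_le_of_lipschitz_of f ?_ 1 (fun i => ?_) w
    · change ∀ e : Fin 3, _
      intro e
      fin_cases e <;> simp [f, MetricGraph.pathLength, thetaX, thetaGraph, rose, roseGraph]
      positivity
    · change FreeGroup.of i = 1 * φ (markX (FreeGroup.of i)) * 1⁻¹
      fin_cases i
      · simp only [Fin.zero_eta]
        rw [markX_of_zero, map_mul, map_inv, h0, h1]
        group
      · simp only [Fin.mk_one]
        rw [markX_of_one, map_mul, map_inv, h1, h2]
        group
  · intro k w
    rw [T_unitLength_eq]
    let f : Fin 2 → List (Fin 3 × Bool) := ![[((0 : Fin 3), true), ((1 : Fin 3), false)],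
      [((2 : Fin 3), true), ((1 : Fin 3), false)]]
    let φ : FreeGroup (Fin 2) →* FreeGroup (Fin 3) := FreeGroup.lift fun e => FreeGroup.mk (f e)
    refine MarkedGraph.length_le_of_lipschitz_of f ?_ 1 (fun i => ?_) w
    · change ∀ e : Fin 2, _
      intro e
      have hk := add_le_stretch hα hα' (inv_nat_pos k)
      fin_cases e
      · simpa [f, MetricGraph.pathLength, thetaX, thetaGraph, rose, roseGraph] using hk.1
      · simpa [f, MetricGraph.pathLength, thetaX, thetaGraph, rose, roseGraph] using hk.2
    · change markX (FreeGroup.of i) = 1 * φ (FreeGroup.of i) * 1⁻¹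
      rw [inv_one, one_mul, mul_one]
      fin_cases i
      · exact markX_of_zero
      · exact markX_of_one

theorem T_mem_closure_simplexY (α : Set.Ioo (0 : ℝ) 1) : T α ∈ closure simplexY := by
  have hα : 0 < (α : ℝ) := α.2.1
  have hα' : 0 < 1 - (α : ℝ) := sub_pos.2 α.2.2
  refine mem_closure_of_tendsto (b := atTop) (tendsto_T_of_bounds
    (F := fun k => thetaY _ (nearT_pos α k)) (C := 1 / α + 1 / (1 - α)) (fun k => ?_) ?_ ?_)
    (Eventually.of_forall fun k => ⟨_, _, rfl⟩)
  · simp only [thetaY_volume, Matrix.cons_val]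
    ring
  · intro k w
    rw [T_unitLength_eq, ← one_mul ((thetaY _ _).length w)]
    let f : Fin 3 → List (Fin 2 × Bool) := ![[((0 : Fin 2), true)], [], [((1 : Fin 2), false)]]
    let φ : FreeGroup (Fin 3) →* FreeGroup (Fin 2) := FreeGroup.lift fun e => FreeGroup.mk (f e)
    have h0 : φ (FreeGroup.of 0) = FreeGroup.of 0 := FreeGroup.lift_apply_of
    have h1 : φ (FreeGroup.of 1) = 1 := FreeGroup.lift_apply_of
    have h2 : φ (FreeGroup.of 2) = (FreeGroup.of 1)⁻¹ := FreeGroup.lift_apply_of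
    refine MarkedGraph.length_le_of_lipschitz_of f ?_ 1 (fun i => ?_) w
    · change ∀ e : Fin 3, _
      intro e
      fin_cases e <;> simp [f, MetricGraph.pathLength, thetaY, thetaGraph, rose, roseGraph]
      positivity
    · change FreeGroup.of i = 1 * φ (markY (FreeGroup.of i)) * 1⁻¹
      fin_cases i
      · simp only [Fin.zero_eta]
        rw [markY_of_zero, map_mul, map_inv, h0, h1]
        group
      · simp only [Fin.mk_one]
        rw [markY_of_one, map_mul, map_inv, h1, h2]
        group
  · intro k w
    rw [T_unitLength_eq]
    let f : Fin 2 → List (Fin 3 × Bool) := ![[((0 : Fin 3), true), ((1 : Fin 3), false)],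
      [((1 : Fin 3), true), ((2 : Fin 3), false)]]
    let φ : FreeGroup (Fin 2) →* FreeGroup (Fin 3) := FreeGroup.lift fun e => FreeGroup.mk (f e)
    refine MarkedGraph.length_le_of_lipschitz_of f ?_ 1 (fun i => ?_) w
    · change ∀ e : Fin 2, _
      intro e
      have hk := add_le_stretch hα hα' (inv_nat_pos k)
      fin_cases e
      · simpa [f, MetricGraph.pathLength, thetaY, thetaGraph, rose, roseGraph] using hk.1
      · simpa [f, MetricGraph.pathLength, thetaY, thetaGraph, rose, roseGraph, add_comm] using hk.2
    · change markY (FreeGroup.of i) = 1 * φ (FreeGroup.of i) * 1⁻¹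
      rw [inv_one, one_mul, mul_one]
      fin_cases i
      · exact markY_of_zero
      · exact markY_of_one

theorem closure_inter_closure : closure simplexX ∩ closure simplexY = Set.range T := by
  refine Set.Subset.antisymm (fun Z hZ => ?_) ?_
  · exact CV.exists_eq_T Z (closure_simplexX_subset hZ.1) (closure_simplexY_subset hZ.2)
  · rintro _ ⟨α, rfl⟩
    exact ⟨T_mem_closure_simplexX α, T_mem_closure_simplexY α⟩


/-! ### Geodesics from `X` to `Y` -/

theorem mul_le_of_log_add_le {p q r : ℝ} (hp : 0 < p) (hq : 0 < q) (hr : 0 < r)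
    (h : Real.log p + Real.log q ≤ Real.log r) : p * q ≤ r := by
  rwa [← Real.log_mul hp.ne' hq.ne', Real.log_le_log_iff (mul_pos hp hq) hr] at h

/-- Equality of `l(ab)` and `l(ab⁻¹)` alone would also allow points with disjoint axes. These are
put into the open set on the side of `Y`, which stays disjoint from the other one because disjoint
axes give equal products. The point outside both sets is then a rose. -/
theorem path_meets_edge (γ : Path X Y) : ∃ t, γ t ∈ Set.range T := by
  have ha := FreeGroup.of_ne_one (0 : Fin 2)
  have hb := FreeGroup.of_ne_one (1 : Fin 2)
  obtain ⟨t, h1, h2⟩ := exists_mem_of_isOpen γ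
    (CV.isOpen_lt (FreeGroup.of 0 * (FreeGroup.of 1)⁻¹) (FreeGroup.of 0 * FreeGroup.of 1))
    ((CV.isOpen_lt (FreeGroup.of 0 * FreeGroup.of 1) (FreeGroup.of 0 * (FreeGroup.of 1)⁻¹)).union
      ((CV.isOpen_add_lt (FreeGroup.of 0) (FreeGroup.of 1) (FreeGroup.of 0 * FreeGroup.of 1)).inter
        (CV.isOpen_add_lt (FreeGroup.of 0) (FreeGroup.of 1)
          (FreeGroup.of 0 * (FreeGroup.of 1)⁻¹))))
    (Set.disjoint_left.2 fun Z h h' => by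
      simp only [Set.mem_union, Set.mem_inter_iff, Set.mem_ofPred_eq] at h h'
      rcases h' with h' | h'
      · exact h.not_gt h'
      · exact h.ne' (Z.unitLength_mul_eq_of_lt ha hb (Or.inl h'.1)))
    (by simp only [Set.mem_ofPred_eq, X_unitLength]; norm_num)
    (by left; simp only [Set.mem_ofPred_eq, Y_unitLength]; norm_num)
  refine ⟨t, ?_⟩
  generalize γ t = Z at h1 h2
  simp only [Set.mem_union, Set.mem_inter_iff, Set.mem_ofPred_eq, not_or, not_and_or,
    not_lt] at h1 h2
  have he := le_antisymm h1 h2.1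
  have h3 : Z.unitLength (FreeGroup.of 0 * FreeGroup.of 1) =
      Z.unitLength (FreeGroup.of 0) + Z.unitLength (FreeGroup.of 1) := by
    rcases h2.2 with h | h <;> rcases Z.le_unitLength_mul_or ha hb with h' | h' <;> linarith
  exact Z.exists_eq_T h3 (by linarith)

theorem CV.ne_one_of_unitLength {n : ℕ} {Z : CV n} {w : FreeGroup (Fin n)}
    (h : 0 < Z.unitLength w) : w ≠ 1 := by
  rintro rfl
  rw [CV.unitLength_one] at h
  exact h.false

theorem a_mul_b_ne_one : FreeGroup.of (0 : Fin 2) * FreeGroup.of 1 ≠ 1 :=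
  CV.ne_one_of_unitLength (Z := X) (by rw [X_unitLength.2.2.1]; norm_num)

theorem a_mul_b_inv_ne_one : FreeGroup.of (0 : Fin 2) * (FreeGroup.of 1)⁻¹ ≠ 1 :=
  CV.ne_one_of_unitLength (Z := X) (by rw [X_unitLength.2.2.2]; norm_num)

/-- The word `ab⁻¹` uses up a factor 3/2 between `X` and `T_α`, leaving at most 4/3 for the rest.
The words `a` and `b` then give `α ≥ 5/8` and `1 - α ≥ 3/8`. -/
theorem eq_of_dR_geodesic {γ : Path X Y} (hγ : IsGeodesic CV.dR γ) {t : unitInterval}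
    {α : Set.Ioo (0 : ℝ) 1} (h : γ t = T α) : (α : ℝ) = 5 / 8 := by
  have h1 := mul_le_of_log_add_le (CV.stretchR_pos _ _) (CV.stretchR_pos _ _)
    (CV.stretchR_pos _ _) (hγ.add_le t)
  have h2 := h1.trans stretchR_X_Y_le
  rw [h] at h2
  have k1 := CV.ratio_le_stretchR X (T α) a_mul_b_inv_ne_one
  have k2 := CV.ratio_le_stretchR (T α) Y (FreeGroup.of_ne_one (0 : Fin 2))
  have k3 := CV.ratio_le_stretchR (T α) Y (FreeGroup.of_ne_one (1 : Fin 2))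
  rw [(T_unitLength α).2.2.2, X_unitLength.2.2.2] at k1
  rw [(T_unitLength α).1, Y_unitLength.1] at k2
  rw [(T_unitLength α).2.1, Y_unitLength.2.1] at k3
  have hα : 0 < (α : ℝ) := α.2.1
  have hα' : 0 < 1 - (α : ℝ) := sub_pos.2 α.2.2
  have h3 : CV.stretchR (T α) Y ≤ 4 / 3 := by
    nlinarith [CV.stretchR_pos (T α) Y]
  have k4 := (div_le_iff₀ hα).1 (k2.trans h3)
  have k5 := (div_le_iff₀ hα').1 (k3.trans h3)
  linarith

/-- Here `ab` uses up a factor 3/2 between `T_α` and `Y`, and `a`, `b` give `α ≥ 3/8` and `1 - α ≥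
5/8` on the first leg. -/
theorem eq_of_dL_geodesic {γ : Path X Y} (hγ : IsGeodesic CV.dL γ) {t : unitInterval}
    {α : Set.Ioo (0 : ℝ) 1} (h : γ t = T α) : (α : ℝ) = 3 / 8 := by
  have h1 := mul_le_of_log_add_le (CV.stretchL_pos _ _) (CV.stretchL_pos _ _)
    (CV.stretchL_pos _ _) (hγ.add_le t)
  have h2 := h1.trans stretchL_X_Y_le
  rw [h] at h2
  have k1 := CV.ratio_le_stretchL (T α) Y a_mul_b_ne_one
  have k2 := CV.ratio_le_stretchL X (T α) (FreeGroup.of_ne_one (0 : Fin 2))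
  have k3 := CV.ratio_le_stretchL X (T α) (FreeGroup.of_ne_one (1 : Fin 2))
  rw [(T_unitLength α).2.2.1, Y_unitLength.2.2.1] at k1
  rw [(T_unitLength α).1, X_unitLength.1] at k2
  rw [(T_unitLength α).2.1, X_unitLength.2.1] at k3
  have hα : 0 < (α : ℝ) := α.2.1
  have hα' : 0 < 1 - (α : ℝ) := sub_pos.2 α.2.2
  have h3 : CV.stretchL X (T α) ≤ 4 / 3 := by
    nlinarith [CV.stretchL_pos X (T α)]
  have k4 := (div_le_iff₀ hα).1 (k2.trans h3)
  have k5 := (div_le_iff₀ hα').1 (k3.trans h3)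
  linarith

/-! ### The symmetric metric -/

/-- Along a `d`-geodesic, a point where `x * y` and `x * y⁻¹` have the same length would give `x` and
`y` too large a length. -/
theorem not_exists_d_geodesic {n : ℕ} [NeZero n] {P Q : CV n} {x y : FreeGroup (Fin n)} (hx : x ≠ 1)
    (hy : y ≠ 1) {s : ℝ} (hs : 0 < s)
    (Pxy : P.unitLength (x * y) = 4 / 3 * s) (Pxy' : P.unitLength (x * y⁻¹) = 2 / 3 * s)
    (Py : P.unitLength y = 5 / 6 * s)
    (Qx : Q.unitLength x = 5 / 6 * s) (Qxy : Q.unitLength (x * y) = 2 / 3 * s)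
    (Qxy' : Q.unitLength (x * y⁻¹) = 4 / 3 * s)
    (hR : CV.stretchR P Q ≤ 2) (hL : CV.stretchL P Q ≤ 2) :
    ¬ ∃ γ : Path P Q, IsGeodesic CV.d γ := by
  rintro ⟨γ, hγ⟩
  obtain ⟨t, h1, h2⟩ := exists_mem_of_isOpen γ (CV.isOpen_lt (x * y⁻¹) (x * y))
    (CV.isOpen_lt (x * y) (x * y⁻¹))
    (Set.disjoint_left.2 fun Z h h' => by
      simp only [Set.mem_ofPred_eq] at h h'
      exact lt_asymm h h')
    (by simp only [Set.mem_ofPred_eq, Pxy, Pxy']; linarith)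
    (by simp only [Set.mem_ofPred_eq, Qxy, Qxy']; linarith)
  have h3 := mul_le_of_log_add_le
    (mul_pos (CV.stretchR_pos _ _) (CV.stretchL_pos _ _))
    (mul_pos (CV.stretchR_pos _ _) (CV.stretchL_pos _ _))
    (mul_pos (CV.stretchR_pos _ _) (CV.stretchL_pos _ _)) (hγ.add_le t)
  generalize γ t = Z at h1 h2 h3
  simp only [Set.mem_ofPred_eq, not_lt] at h1 h2
  have he := le_antisymm h2 h1
  have nxy : x * y ≠ 1 := CV.ne_one_of_unitLength (Z := P) (by rw [Pxy]; positivity)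
  have nxy' : x * y⁻¹ ≠ 1 := CV.ne_one_of_unitLength (Z := P) (by rw [Pxy']; positivity)
  have hc := Z.unitLength_pos nxy
  have hpx := Z.unitLength_pos hx
  have hpy := Z.unitLength_pos hy
  -- The two products are equally long at `Z`, so both alternatives give the same bound.
  have hsum : Z.unitLength x + Z.unitLength y ≤ Z.unitLength (x * y) := by
    rcases Z.le_unitLength_mul_or hx hy with h | h <;> linarith
  have r1 := CV.ratio_le_stretchR P Z nxy'
  have r2 := CV.ratio_le_stretchR Z Q nxy'
  have r3 := CV.ratio_le_stretchR Z Q hx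
  have l1 := CV.ratio_le_stretchL P Z nxy
  have l2 := CV.ratio_le_stretchL Z Q nxy
  have l3 := CV.ratio_le_stretchL P Z hy
  rw [Pxy', he] at r1
  rw [Qxy', he] at r2
  rw [Qx] at r3
  rw [Pxy] at l1
  rw [Qxy] at l2
  rw [Py] at l3
  have p1 := CV.stretchR_pos P Z
  have p2 := CV.stretchR_pos Z Q
  have p3 := CV.stretchL_pos P Z
  have p4 := CV.stretchL_pos Z Q
  have p5 := CV.stretchR_pos P Q
  have p6 := CV.stretchL_pos P Q
  generalize CV.stretchR P Z = R₁ at *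
  generalize CV.stretchR Z Q = R₂ at *
  generalize CV.stretchL P Z = L₁ at *
  generalize CV.stretchL Z Q = L₂ at *
  generalize Z.unitLength (x * y) = c at *
  generalize Z.unitLength x = a at *
  generalize Z.unitLength y = b at *
  have h4 : R₁ * L₁ * (R₂ * L₂) ≤ 4 := by
    have := mul_le_mul hR hL p6.le zero_le_two
    linarith
  have q1 : 2 ≤ R₁ * R₂ := by
    have := mul_le_mul r1 r2 (by positivity) p1.le
    have e : c / (2 / 3 * s) * (4 / 3 * s / c) = 2 := by field_simp; norm_num
    linarith
  have q2 : 2 ≤ L₁ * L₂ := by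
    have := mul_le_mul l1 l2 (by positivity) p3.le
    have e : 4 / 3 * s / c * (c / (2 / 3 * s)) = 2 := by field_simp; norm_num
    linarith
  -- The two products multiply to at most 4 and each is at least 2, so a `d`-geodesic is sharp for
  -- both factors separately.
  have q3 : R₁ * R₂ ≤ 2 := by nlinarith [mul_pos p1 p2, mul_pos p3 p4]
  have q4 : L₁ * L₂ ≤ 2 := by nlinarith [mul_pos p1 p2, mul_pos p3 p4]
  have e1 : 5 / 8 * c ≤ a := by
    have := mul_le_mul r1 r3 (by positivity) p1.le
    have e : c / (2 / 3 * s) * (5 / 6 * s / a) = 5 / 4 * c / a := by field_simp; norm_num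
    rw [e] at this
    have := (div_le_iff₀ hpx).1 (this.trans q3)
    linarith
  have e2 : 5 / 8 * c ≤ b := by
    have := mul_le_mul l3 l2 (by positivity) p3.le
    have e : 5 / 6 * s / b * (c / (2 / 3 * s)) = 5 / 4 * c / b := by field_simp; norm_num
    rw [e] at this
    have := (div_le_iff₀ hpy).1 (this.trans q4)
    linarith
  -- Now `5/4 * c ≤ a + b ≤ c` with `c` positive.
  linarith

theorem not_exists_d_geodesic_X_Y : ¬ ∃ γ : Path X Y, IsGeodesic CV.d γ := by
  have hX := X_unitLength
  have hY := Y_unitLength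
  exact not_exists_d_geodesic (FreeGroup.of_ne_one (0 : Fin 2)) (FreeGroup.of_ne_one (1 : Fin 2))
    one_pos (by rw [hX.2.2.1, mul_one]) (by rw [hX.2.2.2, mul_one])
    (by rw [hX.2.1, mul_one]) (by rw [hY.1, mul_one]) (by rw [hY.2.2.1, mul_one])
    (by rw [hY.2.2.2, mul_one]) stretchR_X_Y_le stretchL_X_Y_le

/-! ### Higher rank -/

section MultiTheta

variable {k : ℕ}

/-- The graph with two vertices and `k + 3` edges, from `false` to `true`. -/
def multiTheta (ℓ : Option (Fin (k + 2)) → ℝ) (hℓ : ∀ i, 0 < ℓ i) : MetricGraph where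
  V := Bool
  E := Option (Fin (k + 2))
  src _ := false
  tgt _ := true
  len := ℓ
  len_pos := hℓ

theorem multiTheta_isWalk (ℓ : Option (Fin (k + 2)) → ℝ) (hℓ : ∀ i, 0 < ℓ i)
    (e e' : Option (Fin (k + 2))) :
    (multiTheta ℓ hℓ).IsWalk false [(e, true), (e', false)] false := ⟨rfl, rfl, rfl⟩

/-- A marking of the graph with `k + 3` edges by loops of two edges. -/
def multiThetaMarked (ℓ : Option (Fin (k + 2)) → ℝ) (hℓ : ∀ i, 0 < ℓ i)
    (p q : Fin (k + 2) → Option (Fin (k + 2)))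
    (ψ : FreeGroup (Option (Fin (k + 2))) →* FreeGroup (Fin (k + 2)))
    (h1 : ∀ i, ψ (FreeGroup.of (p i)) * (ψ (FreeGroup.of (q i)))⁻¹ = FreeGroup.of i)
    (h2 : ∀ e, FreeGroup.lift (fun i => FreeGroup.of (p i) * (FreeGroup.of (q i))⁻¹)
      (ψ (FreeGroup.of e)) = FreeGroup.of e * (FreeGroup.of none)⁻¹) : MarkedGraph (k + 2) where
  toMetricGraph := multiTheta ℓ hℓ
  connected := by
    intro u w
    cases u <;> cases w
    · exact ⟨[], rfl⟩
    · exact ⟨[(none, true)], rfl, rfl⟩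
    · exact ⟨[(none, false)], rfl, rfl⟩
    · exact ⟨[], rfl⟩
  three_le_valence v := by
    have hinj : Function.Injective (fun i : Option (Fin (k + 2)) =>
        (⟨(i, !v), by cases v <;> rfl⟩ :
          {x : (multiTheta ℓ hℓ).E × Bool // (multiTheta ℓ hℓ).start x = v})) := by
      intro i j h
      exact congrArg (fun x => x.1.1) h
    have := Nat.card_le_card_of_injective _ hinj
    rw [Nat.card_eq_fintype_card, Fintype.card_option, Fintype.card_fin] at this
    exact le_trans (by omega) this
  base := false
  marking := FreeGroup.lift fun i => FreeGroup.of (p i) * (FreeGroup.of (q i))⁻¹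
  marking_injective := by
    have h : ψ.comp (FreeGroup.lift fun i => FreeGroup.of (p i) * (FreeGroup.of (q i))⁻¹) =
        MonoidHom.id _ := by
      ext i
      rw [MonoidHom.comp_apply, FreeGroup.lift_apply_of, map_mul, map_inv, h1]
      rfl
    exact Function.LeftInverse.injective (DFunLike.congr_fun h)
  marking_range := by
    -- The edge `none` serves as maximal tree: the vertex `true` is joined to the base point along
    -- it.
    have h3 : ∀ e : Option (Fin (k + 2)), FreeGroup.of e * (FreeGroup.of none)⁻¹ =
        1⁻¹ * FreeGroup.of e * (FreeGroup.of none)⁻¹ := fun e => by rw [inv_one, one_mul]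
    refine fundamentalGroup_eq_range (multiTheta ℓ hℓ) false _ ψ
      (fun v => bif v then (FreeGroup.of (none : Option (Fin (k + 2))))⁻¹ else 1) rfl
      (fun i => ?_) fun e => ?_
    · exact ⟨_, multiTheta_isWalk ℓ hℓ (p i) (q i), FreeGroup.lift_apply_of.symm⟩
    · exact (h2 e).trans (h3 e)

/-- The edge lengths: `1/3` for `none`, and `u, v, 1, …, 1` for the other edges. -/
noncomputable def edgeLengths (u v : ℝ) : Option (Fin (k + 2)) → ℝ
  | none => 1 / 3
  | some i => if i = 0 then u else if i = 1 then v else 1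

theorem edgeLengths_zero (u v : ℝ) : edgeLengths u v (some (0 : Fin (k + 2))) = u := by
  simp [edgeLengths]

theorem edgeLengths_one (u v : ℝ) : edgeLengths u v (some (1 : Fin (k + 2))) = v := by
  simp [edgeLengths]

theorem edgeLengths_pos {u v : ℝ} (hu : 0 < u) (hv : 0 < v) (e : Option (Fin (k + 2))) :
    0 < edgeLengths u v e := by
  rcases e with _ | i
  · norm_num [edgeLengths]
  · simp only [edgeLengths]
    split_ifs <;> first | assumption | norm_num

theorem sum_edgeLengths (u v : ℝ) :
    ∑ e : Option (Fin (k + 2)), edgeLengths u v e = 1 / 3 + (u + (v + k)) := by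
  have h : ∀ i : Fin k, i.succ.succ ≠ 1 := fun i h => by
    rw [← Fin.succ_zero_eq_one, Fin.succ_inj] at h
    exact Fin.succ_ne_zero _ h
  rw [Fintype.sum_option, Fin.sum_univ_succ, Fin.sum_univ_succ]
  simp [edgeLengths, h]

/-- The graph of `X` with `k` additional edges of length one. -/
noncomputable def multiX (k : ℕ) : MarkedGraph (k + 2) :=
  multiThetaMarked (edgeLengths (1 / 6) (1 / 2)) (edgeLengths_pos (by norm_num) (by norm_num))
    some (fun _ => none) (FreeGroup.lift fun e => e.elim 1 FreeGroup.of) (fun i => by simp)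
    fun e => by cases e <;> simp

/-- The graph of `Y` with `k` additional edges of length one. -/
noncomputable def multiY (k : ℕ) : MarkedGraph (k + 2) :=
  multiThetaMarked (edgeLengths (1 / 2) (1 / 6)) (edgeLengths_pos (by norm_num) (by norm_num))
    (fun i => if i = 1 then none else some i) (fun i => if i = 1 then some 1 else none)
    (FreeGroup.lift fun e => e.elim 1 fun i => if i = 1 then (FreeGroup.of 1)⁻¹ else FreeGroup.of i)
    (fun i => by by_cases h : i = 1 <;> simp [h])
    fun e => by
      rcases e with _ | i
      · simp
      · by_cases h : i = 1 <;> simp [h]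

theorem multiX_volume : (multiX k).volume = 1 + k := by
  refine (sum_edgeLengths (1 / 6) (1 / 2)).trans ?_
  ring

theorem multiY_volume : (multiY k).volume = 1 + k := by
  refine (sum_edgeLengths (1 / 2) (1 / 6)).trans ?_
  ring

theorem multiX_marking (i : Fin (k + 2)) : (multiX k).marking (FreeGroup.of i) =
    FreeGroup.of (some i : Option (Fin (k + 2))) * (FreeGroup.of none)⁻¹ :=
  FreeGroup.lift_apply_of

theorem multiY_marking (i : Fin (k + 2)) : (multiY k).marking (FreeGroup.of i) =
    FreeGroup.of (if i = 1 then none else some i : Option (Fin (k + 2))) *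
      (FreeGroup.of (if i = 1 then some 1 else none))⁻¹ :=
  FreeGroup.lift_apply_of

theorem multiX_length :
    (multiX k).length (FreeGroup.of 0) = 1 / 2 ∧ (multiX k).length (FreeGroup.of 1) = 5 / 6 ∧
      (multiX k).length (FreeGroup.of 0 * FreeGroup.of 1) = 4 / 3 ∧
      (multiX k).length (FreeGroup.of 0 * (FreeGroup.of 1)⁻¹) = 2 / 3 := by
  have h01 : (some 0 : Option (Fin (k + 2))) ≠ none ∧ (some 0 : Option (Fin (k + 2))) ≠ some 1 ∧
    (none : Option (Fin (k + 2))) ≠ some 1 := by simp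
  have h := MarkedGraph.length_of_theta (A := multiX k) (e₀ := some (0 : Fin (k + 2))) (e₁ := none)
    (e₂ := some (1 : Fin (k + 2))) h01.1 h01.2.1 h01.2.2 (fun _ => rfl) (v := true) (fun _ => rfl)
    (multiX_marking 0) (multiX_marking 1)
  have l0 : (multiX k).len (some (0 : Fin (k + 2))) = 1 / 6 := edgeLengths_zero (k := k) (1 / 6) (1 / 2)
  have l1 : (multiX k).len none = 1 / 3 := rfl
  have l2 : (multiX k).len (some (1 : Fin (k + 2))) = 1 / 2 := edgeLengths_one (k := k) (1 / 6) (1 / 2)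
  rw [l0, l1, l2] at h
  norm_num at h ⊢
  exact h

theorem multiY_length :
    (multiY k).length (FreeGroup.of 0) = 5 / 6 ∧ (multiY k).length (FreeGroup.of 1) = 1 / 2 ∧
      (multiY k).length (FreeGroup.of 0 * FreeGroup.of 1) = 2 / 3 ∧
      (multiY k).length (FreeGroup.of 0 * (FreeGroup.of 1)⁻¹) = 4 / 3 := by
  have h01 : (some 0 : Option (Fin (k + 2))) ≠ none ∧ (some 0 : Option (Fin (k + 2))) ≠ some 1 ∧
    (none : Option (Fin (k + 2))) ≠ some 1 := by simp
  have hm : ((FreeGroup.of (none : Option (Fin (k + 2)))) * (FreeGroup.of (some 1))⁻¹)⁻¹ =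
    FreeGroup.of (some 1) * (FreeGroup.of none)⁻¹ := by group
  have m0 := multiY_marking (0 : Fin (k + 2))
  have m1 := multiY_marking (1 : Fin (k + 2))
  rw [if_neg (by simp), if_neg (by simp)] at m0
  rw [if_pos rfl, if_pos rfl] at m1
  have h := MarkedGraph.length_of_theta (A := multiY k) (y := (FreeGroup.of 1)⁻¹)
    (e₀ := some (0 : Fin (k + 2))) (e₁ := none)
    (e₂ := some (1 : Fin (k + 2))) h01.1 h01.2.1 h01.2.2 (fun _ => rfl) (v := true) (fun _ => rfl)
    m0 ((map_inv (multiY k).marking _).trans ((congrArg _ m1).trans hm))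
  have l0 : (multiY k).len (some (0 : Fin (k + 2))) = 1 / 2 := edgeLengths_zero (k := k) (1 / 2) (1 / 6)
  have l1 : (multiY k).len none = 1 / 3 := rfl
  have l2 : (multiY k).len (some (1 : Fin (k + 2))) = 1 / 6 := edgeLengths_one (k := k) (1 / 2) (1 / 6)
  rw [l0, l1, l2, MarkedGraph.length_inv, inv_inv] at h
  norm_num at h ⊢
  exact ⟨h.1, h.2.1, h.2.2.2, h.2.2.1⟩

/-- The map of `stretchR_X_Y_le` is extended to the additional edges. Their images have length `1/2
+ 1 + 1/3 = 11/6`, so length one is enough to keep their stretch below 2. -/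
theorem stretchR_multiX_multiY_le : CV.stretchR (CV.of (multiX k)) (CV.of (multiY k)) ≤ 2 := by
  refine CV.stretchR_le (by rw [multiX_volume, multiY_volume]) (by norm_num) ?_
  let f : Option (Fin (k + 2)) → List (Option (Fin (k + 2)) × Bool) := fun e =>
    e.elim [(some 0, false)] fun i =>
      if i = 0 then [(none, false)] else
        if i = 1 then [(some 0, false), (none, true), (some 1, false)] else
          [(some 0, false), (some i, true), (none, false)]
  let φ : FreeGroup (Option (Fin (k + 2))) →* FreeGroup (Option (Fin (k + 2))) :=
    FreeGroup.lift fun e => FreeGroup.mk (f e)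
  have hn : φ (FreeGroup.of none) = (FreeGroup.of (some 0))⁻¹ := FreeGroup.lift_apply_of
  have hs : ∀ i, φ (FreeGroup.of (some i)) = if i = 0 then (FreeGroup.of none)⁻¹ else
      if i = 1 then (FreeGroup.of (some 0))⁻¹ * FreeGroup.of none * (FreeGroup.of (some 1))⁻¹ else
        (FreeGroup.of (some 0))⁻¹ * FreeGroup.of (some i) * (FreeGroup.of none)⁻¹ := by
    intro i
    refine FreeGroup.lift_apply_of.trans ?_
    simp only [f, Option.elim_some]
    split_ifs <;> rfl
  have hφ : ∀ i : Fin (k + 2),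
      FreeGroup.of (if i = 1 then none else some i : Option (Fin (k + 2))) *
        (FreeGroup.of (if i = 1 then some 1 else none))⁻¹ =
      FreeGroup.of (some 0) * φ (FreeGroup.of (some i) * (FreeGroup.of none)⁻¹) *
        (FreeGroup.of (some 0))⁻¹ := by
    intro i
    rw [map_mul, map_inv, hn, hs]
    by_cases h0 : i = 0
    · subst h0
      rw [if_neg (by simp), if_neg (by simp), if_pos rfl]
      group
    · by_cases h1 : i = 1
      · subst h1
        rw [if_pos rfl, if_pos rfl, if_neg h0, if_pos rfl]
        group
      · rw [if_neg h1, if_neg h1, if_neg h0, if_neg h1]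
        group
  have hlen : ∀ e : Option (Fin (k + 2)),
      ((f e).map fun z => edgeLengths (1 / 2) (1 / 6) z.1).sum ≤
        2 * edgeLengths (1 / 6) (1 / 2) e := by
    rintro (_ | i)
    · simp [f, edgeLengths]
      norm_num
    · by_cases h0 : i = 0
      · simp [f, edgeLengths, h0]
        norm_num
      · by_cases h1 : i = 1
        · simp [f, edgeLengths, h1]
          norm_num
        · simp [f, edgeLengths, h0, h1]
          norm_num
  exact MarkedGraph.length_le_of_lipschitz_of (A := multiX k) (B := multiY k) f hlen
    (FreeGroup.of (some 0 : Option (Fin (k + 2)))) fun i =>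
      (multiY_marking i).trans ((hφ i).trans (by rw [multiX_marking]; rfl))

/-- The map of `stretchL_X_Y_le` is extended; the additional edges are again stretched by `11/6`. -/
theorem stretchL_multiX_multiY_le : CV.stretchL (CV.of (multiX k)) (CV.of (multiY k)) ≤ 2 := by
  refine CV.stretchR_le (by rw [multiX_volume, multiY_volume]) (by norm_num) ?_
  let f : Option (Fin (k + 2)) → List (Option (Fin (k + 2)) × Bool) := fun e =>
    e.elim [(some 1, true)] fun i =>
      if i = 1 then [(none, true)] else [(some i, true), (none, false), (some 1, true)]
  let φ : FreeGroup (Option (Fin (k + 2))) →* FreeGroup (Option (Fin (k + 2))) :=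
    FreeGroup.lift fun e => FreeGroup.mk (f e)
  have hn : φ (FreeGroup.of none) = FreeGroup.of (some 1) := FreeGroup.lift_apply_of
  have hs : ∀ i, φ (FreeGroup.of (some i)) = if i = 1 then FreeGroup.of none else
        FreeGroup.of (some i) * (FreeGroup.of none)⁻¹ * FreeGroup.of (some 1) := by
    intro i
    refine FreeGroup.lift_apply_of.trans ?_
    simp only [f, Option.elim_some]
    split_ifs <;> rfl
  have hφ : ∀ i : Fin (k + 2), FreeGroup.of (some i) * (FreeGroup.of none)⁻¹ =
      1 * φ (FreeGroup.of (if i = 1 then none else some i : Option (Fin (k + 2))) *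
        (FreeGroup.of (if i = 1 then some 1 else none))⁻¹) * 1⁻¹ := by
    intro i
    rw [map_mul, map_inv]
    by_cases h1 : i = 1
    · subst h1
      rw [if_pos rfl, if_pos rfl, hn, hs, if_pos rfl]
      group
    · rw [if_neg h1, if_neg h1, hn, hs, if_neg h1]
      group
  have hlen : ∀ e : Option (Fin (k + 2)),
      ((f e).map fun z => edgeLengths (1 / 6) (1 / 2) z.1).sum ≤
        2 * edgeLengths (1 / 2) (1 / 6) e := by
    rintro (_ | i)
    · simp [f, edgeLengths]
      norm_num
    · by_cases h1 : i = 1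
      · simp [f, edgeLengths, h1]
        norm_num
      · by_cases h0 : i = 0
        · simp [f, edgeLengths, h0]
          norm_num
        · simp [f, edgeLengths, h0, h1]
          norm_num
  exact MarkedGraph.length_le_of_lipschitz_of (A := multiY k) (B := multiX k) f hlen
    (1 : FreeGroup (Option (Fin (k + 2)))) fun i =>
      (multiX_marking i).trans ((hφ i).trans (by rw [multiY_marking]; rfl))

/-- The additional edges leave the lengths of `a`, `b`, `ab`, `ab⁻¹` as in rank two but raise the
volume to `1 + k`. Hence the scale `s = (1 + k)⁻¹`. -/
theorem not_exists_d_geodesic_multiX_multiY :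
    ¬ ∃ γ : Path (CV.of (multiX k)) (CV.of (multiY k)), IsGeodesic CV.d γ := by
  have hX := multiX_length (k := k)
  have hY := multiY_length (k := k)
  have hv : (0 : ℝ) < (1 + (k : ℝ))⁻¹ := by positivity
  refine not_exists_d_geodesic (FreeGroup.of_ne_one (0 : Fin (k + 2)))
    (FreeGroup.of_ne_one (1 : Fin (k + 2))) hv ?_ ?_ ?_ ?_ ?_ ?_
    stretchR_multiX_multiY_le stretchL_multiX_multiY_le <;>
    rw [CV.unitLength_of] <;> simp only [hX, hY, multiX_volume, multiY_volume] <;>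
    exact div_eq_mul_inv _ _

end MultiTheta
end OuterSpaceMetric
theorem mainTheorem12 :
    -- `X` and `Y` lie in theta-graph simplices whose common face is the edge of the roses `T_α`
    (OuterSpaceMetric.X ∈ OuterSpaceMetric.simplexX ∧
      OuterSpaceMetric.Y ∈ OuterSpaceMetric.simplexY ∧
      closure OuterSpaceMetric.simplexX ∩ closure OuterSpaceMetric.simplexY =
        Set.range OuterSpaceMetric.T) ∧
    -- no `d`-geodesic joins them
    (¬ ∃ γ : Path OuterSpaceMetric.X OuterSpaceMetric.Y,
      OuterSpaceMetric.IsGeodesic OuterSpaceMetric.CV.d γ) ∧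
    -- a `d_R`-geodesic meets the common edge, and only at `T_{5/8}`
    (∀ γ : Path OuterSpaceMetric.X OuterSpaceMetric.Y,
      OuterSpaceMetric.IsGeodesic OuterSpaceMetric.CV.dR γ →
        (∃ t, γ t ∈ Set.range OuterSpaceMetric.T) ∧
          ∀ t α, γ t = OuterSpaceMetric.T α → (α : ℝ) = 5 / 8) ∧
    -- a `d_L`-geodesic meets the common edge, and only at `T_{3/8}`
    (∀ γ : Path OuterSpaceMetric.X OuterSpaceMetric.Y,
      OuterSpaceMetric.IsGeodesic OuterSpaceMetric.CV.dL γ →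
        (∃ t, γ t ∈ Set.range OuterSpaceMetric.T) ∧
          ∀ t α, γ t = OuterSpaceMetric.T α → (α : ℝ) = 3 / 8) ∧
    -- hence `CV_n` is not a geodesic space
    ∀ n : ℕ, 2 ≤ n →
      ¬ OuterSpaceMetric.IsGeodesicSpace (OuterSpaceMetric.CV.d (n := n)) := by
  refine ⟨⟨⟨_, _, rfl⟩, ⟨_, _, rfl⟩, OuterSpaceMetric.closure_inter_closure⟩,
    OuterSpaceMetric.not_exists_d_geodesic_X_Y,
    fun γ hγ => ⟨OuterSpaceMetric.path_meets_edge γ,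
      fun t α h => OuterSpaceMetric.eq_of_dR_geodesic hγ h⟩,
    fun γ hγ => ⟨OuterSpaceMetric.path_meets_edge γ,
      fun t α h => OuterSpaceMetric.eq_of_dL_geodesic hγ h⟩,
    fun n hn h => ?_⟩
  obtain ⟨k, rfl⟩ := Nat.exists_eq_add_of_le' hn
  exact OuterSpaceMetric.not_exists_d_geodesic_multiX_multiY (h _ _)
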